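/- **Proposition 3.1 (comparability).** Let $d$ be a natural number and $0<s<1$. For a (positive, not necessarily finite) Radon measure $\mu$ on $\mathbb R^d$ and $0<\varepsilon_1,\varepsilon_2$ let $$R^s_{\varepsilon_1,\varepsilon_2}\mu(x)=\int_{\varepsilon_1<|y-x|\le\varepsilon_2}\frac{y-x}{|y-x|^{1+s}}\,d\mu(y),\qquad x\in\mathbb R^d,$$ be the doubly truncated $s$-Riesz transform of $\mu$ (which is $0$ if $\varepsilon_1\ge\varepsilon_2$), and let $$W(\mu)=\int_{\mathbb R^d}\int_0^\infty\left(\frac{\mu(B(x,r))}{r^s}\right)^2\frac{dr}{r}\,d\mu(x)\in[0,\infty]$$ be its Wolff energy, where $B(x,r)$ is the open ball; that is, $W(\mu)=\int\dot W^{\mu}_{\frac23(d-s),\frac32}\,d\mu$. There is a finite constant $C\ge 0$, depending only on $d$ and $s$, such that the following holds for every Radon measure $\mu$ on $\mathbb R^d$. (a) For all $\varepsilon_1,\varepsilon_2>0$, $$\int|R^s_{\varepsilon_1,\varepsilon_2}\mu(x)|^2\,d\mu(x)\le C\,W(\mu).$$ (b) If $\mu$ has no point masses (i.e. $\mu(\{x\})=0$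 for every $x\in\mathbb R^d$) and $\displaystyle\liminf_{r\to\infty}\frac{\mu(B(0,r))^3}{r^{2s}}<\infty$, then $$W(\mu)\le C\sup_{\varepsilon_2>\varepsilon_1>0}\int|R^s_{\varepsilon_1,\varepsilon_2}\mu(x)|^2\,d\mu(x).$$ -/

import Mathlib

open MeasureTheory Filter Set
open scoped ENNReal NNReal

noncomputable section

/-- The vector valued `s`-Riesz kernel `K^s(x) = x / |x|^(1+s)` on `ℝ^d`. -/
def rieszKernel {d : ℕ} (s : ℝ) (x : EuclideanSpace ℝ (Fin d)) : EuclideanSpace ℝ (Fin d) :=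
  (‖x‖ ^ (1 + s))⁻¹ • x

/-- The doubly truncated `s`-Riesz transform
`R^s_{ε₁,ε₂} μ (x) = ∫_{ε₁ < |y - x| ≤ ε₂} K^s(y - x) dμ(y)`.
For `ε₁ > 0` and `μ` locally finite the integrand is bounded on the (bounded) domain of
integration, so the integral converges absolutely. -/
def truncRiesz {d : ℕ} (s ε₁ ε₂ : ℝ) (μ : Measure (EuclideanSpace ℝ (Fin d)))
    (x : EuclideanSpace ℝ (Fin d)) : EuclideanSpace ℝ (Fin d) :=
  ∫ y in {y | ε₁ < ‖y - x‖ ∧ ‖y - x‖ ≤ ε₂}, rieszKernel s (y - x) ∂μ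

/-- The squared `L²(μ)` norm of `R^s_{ε₁,ε₂} μ`, with values in `[0, ∞]`. -/
def truncRieszEnergy {d : ℕ} (s ε₁ ε₂ : ℝ) (μ : Measure (EuclideanSpace ℝ (Fin d))) : ℝ≥0∞ :=
  ∫⁻ x, ‖truncRiesz s ε₁ ε₂ μ x‖ₑ ^ 2 ∂μ

/-- The average `s`-dimensional density `θ^s_μ(B(x,r)) = μ(B(x,r)) / r^s` (open balls). -/
def density {d : ℕ} (s : ℝ) (μ : Measure (EuclideanSpace ℝ (Fin d)))
    (x : EuclideanSpace ℝ (Fin d)) (r : ℝ) : ℝ≥0∞ :=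
  μ (Metric.ball x r) / ENNReal.ofReal (r ^ s)

/-- The Wolff potential `∫₀^∞ (μ(B(x,r)) / r^s)² dr/r`, that is, the homogeneous Wolff potential
of `μ` with indices `α = (2/3)(d - s)` and `p = 3/2`, for which `d - α p = s`. -/
def wolffPotential {d : ℕ} (s : ℝ) (μ : Measure (EuclideanSpace ℝ (Fin d)))
    (x : EuclideanSpace ℝ (Fin d)) : ℝ≥0∞ :=
  ∫⁻ r in Ioi (0 : ℝ), density s μ x r ^ 2 / ENNReal.ofReal r

/-- The Wolff energy: the integral of the Wolff potential of `μ` against `μ`. -/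
def wolffEnergy {d : ℕ} (s : ℝ) (μ : Measure (EuclideanSpace ℝ (Fin d))) : ℝ≥0∞ :=
  ∫⁻ x, wolffPotential s μ x ∂μ

end

/-! Both energies are compared with the triple energy `∫∫∫ max(|y - x|, |z - x|)^(-2s) dμ³`. For the
Wolff energy this is an identity up to the factor `2s` (`ofReal_mul_wolffEnergy`): `μ(B(x,r))²` is
the `μ ⊗ μ`-mass of the pairs within distance `r` of `x`, and one integrates in `r` first. For the
Riesz energy, expand the square and average over cyclic rotations of `(x, y, z)`; three times the
energy is the integral of a function of the side lengths of the triangle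
(`integrable_kernelSum_and_three_mul_energy`). For `0 < s < 1` this function is at most a constant
times (longest side)^(-2s). It is bounded below by a multiple of the same quantity when all sides
lie between the two truncation radii, and is nonnegative when all sides are at most `ε₂`
(`kernelSum_le`, `le_kernelSum`, `kernelSum_nonneg`). The upper bound gives (a) at once.

In (b), triangles with a side longer than `ε₂` can contribute negatively. Hence `μ` is first
multiplied by a Lipschitz cutoff of radius `ρ` and truncated at `2ρ`, which no triangle in the
support exceeds (`lowerConst_mul_tripleEnergy_le`). The commutator of cutoff and kernel costs
`μ(B(0,4ρ))³ / (4ρ)^(2s)` (`truncRieszEnergy_coneMeasure_le`), which the growth hypothesis keeps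
bounded along some radii. So the triple energy is finite if the supremum is; but finite triple
energy makes this error tend to zero (`tendsto_measure_ball_pow_div`), and a second pass removes it
(`tripleEnergy_le_iSup`). -/

/-! ### Estimates for the symmetrized kernel in terms of side lengths -/

/-- The radial profile of the truncated Riesz kernel. -/
noncomputable def truncProfile (s ε₁ ε₂ t : ℝ) : ℝ :=
  if ε₁ < t ∧ t ≤ ε₂ then (t ^ (1 + s))⁻¹ else 0

/-- Twice the cyclic sum of the scalar products `g(|u|) g(|v|) ⟪u, v⟫` over the three vertices of a
triangle with sides `a`, `b`, `c`, where `u`, `v` are the edges emanating from the vertex. -/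
def sideForm (g : ℝ → ℝ) (a b c : ℝ) : ℝ :=
  g b * g c * (b ^ 2 + c ^ 2 - a ^ 2) + g a * g c * (a ^ 2 + c ^ 2 - b ^ 2)
    + g a * g b * (a ^ 2 + b ^ 2 - c ^ 2)

lemma truncProfile_nonneg {s ε₁ ε₂ t : ℝ} (hε : 0 < ε₁) : 0 ≤ truncProfile s ε₁ ε₂ t := by
  unfold truncProfile
  split_ifs with h
  · have := hε.trans h.1
    positivity
  · rfl

lemma truncProfile_le {s ε₁ ε₂ t : ℝ} (ht : 0 < t) :
    truncProfile s ε₁ ε₂ t ≤ (t ^ (1 + s))⁻¹ := by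
  unfold truncProfile
  split_ifs with h
  · rfl
  · positivity

lemma truncProfile_mul_le {s ε₁ ε₂ t : ℝ} (ht : 0 < t) :
    truncProfile s ε₁ ε₂ t * t ≤ t ^ (-s) := by
  calc _ ≤ (t ^ (1 + s))⁻¹ * t := by gcongr; exact truncProfile_le ht
    _ = t ^ (-s) := by
      rw [← Real.rpow_neg ht.le]
      nth_rewrite 2 [← Real.rpow_one t]
      rw [← Real.rpow_add ht]
      congr 1
      ring

lemma truncProfile_le_of_le {s ε₁ ε₂ b a : ℝ} (hs : 0 < s) (hε : 0 < ε₁) (hb : ε₁ < b)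
    (hba : b ≤ a) : truncProfile s ε₁ ε₂ a ≤ truncProfile s ε₁ ε₂ b := by
  by_cases h : a ≤ ε₂
  · have hb0 := hε.trans hb
    simp only [truncProfile, hb, hb.trans_le hba, h, hba.trans h, and_self, if_true]
    gcongr
  · simp only [truncProfile, h, and_false, if_false]
    exact truncProfile_nonneg hε

/-- Regrouping around the smallest side `c` leaves three terms bounded by multiples of `b ^ (-2s)`
and one that is nonpositive. Here `s < 1` makes `c ^ (1 - s)` increasing, so a short side does no
harm, and `b ≥ a / 2` by the triangle inequality. -/
lemma sideForm_le_of_sorted {s ε₁ ε₂ a b c : ℝ} (hs₀ : 0 < s) (hs₁ : s < 1) (hε : 0 < ε₁)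
    (hc : 0 ≤ c) (hcb : c ≤ b) (hba : b ≤ a) (habc : a ≤ b + c) (hb : 0 < b) :
    sideForm (truncProfile s ε₁ ε₂) a b c ≤ 16 * a ^ (-(2 * s)) := by
  set g := truncProfile s ε₁ ε₂ with hg
  have ha : 0 < a := hb.trans_le hba
  have g0 : ∀ t, 0 ≤ g t := fun t => truncProfile_nonneg hε
  have hgb : g b * b ≤ b ^ (-s) := truncProfile_mul_le hb
  have hga : g a * b ≤ b ^ (-s) := by
    calc g a * b ≤ g a * a := by gcongr; exact g0 a
      _ ≤ a ^ (-s) := truncProfile_mul_le ha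
      _ ≤ b ^ (-s) := Real.rpow_le_rpow_of_nonpos hb hba (by linarith)
  have hgc : g c * c ^ 2 ≤ b * b ^ (-s) := by
    rcases hc.eq_or_lt with h | h
    · rw [← h]; simp; positivity
    · calc g c * c ^ 2 = g c * c * c := by ring
        _ ≤ c ^ (-s) * c := by gcongr; exact truncProfile_mul_le h
        _ = c ^ (1 - s) := by
          nth_rewrite 2 [← Real.rpow_one c]
          rw [← Real.rpow_add h]; congr 1; ring
        _ ≤ b ^ (1 - s) := by gcongr
        _ = b * b ^ (-s) := by
          nth_rewrite 2 [← Real.rpow_one b]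
          rw [← Real.rpow_add hb]; congr 1
  -- No size bound is needed for this term: beyond `ε₁` the profile is nonincreasing, including its
  -- drop to `0` at `ε₂`, and `g c` vanishes when `c ≤ ε₁`.
  have hmono : g c * ((g b - g a) * (b ^ 2 - a ^ 2)) ≤ 0 := by
    by_cases h : ε₁ < c
    · have : g a ≤ g b := truncProfile_le_of_le hs₀ hε (h.trans_le hcb) hba
      have h2 : b ^ 2 ≤ a ^ 2 := by gcongr
      exact mul_nonpos_of_nonneg_of_nonpos (g0 c)
        (mul_nonpos_of_nonneg_of_nonpos (by linarith) (by linarith))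
    · have : g c = 0 := by simp [hg, truncProfile, h]
      simp [this]
  have h1 : g c * c ^ 2 * g a ≤ b ^ (-s) * b ^ (-s) := by
    calc g c * c ^ 2 * g a ≤ b * b ^ (-s) * g a := by gcongr; exact g0 a
      _ = b ^ (-s) * (g a * b) := by ring
      _ ≤ _ := by gcongr
  have h2 : g c * c ^ 2 * g b ≤ b ^ (-s) * b ^ (-s) := by
    calc g c * c ^ 2 * g b ≤ b * b ^ (-s) * g b := by gcongr; exact g0 b
      _ = b ^ (-s) * (g b * b) := by ring
      _ ≤ _ := by gcongr
  have h3 : g a * g b * (a ^ 2 + b ^ 2 - c ^ 2) ≤ 2 * (b ^ (-s) * b ^ (-s)) := by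
    have : a ^ 2 + b ^ 2 - c ^ 2 ≤ 2 * a * b := by nlinarith
    calc g a * g b * (a ^ 2 + b ^ 2 - c ^ 2) ≤ g a * g b * (2 * a * b) := by
          gcongr; exact mul_nonneg (g0 a) (g0 b)
      _ = 2 * ((g a * a) * (g b * b)) := by ring
      _ ≤ 2 * (a ^ (-s) * b ^ (-s)) := by
          gcongr
          · exact mul_nonneg (g0 b) hb.le
          · exact truncProfile_mul_le ha
      _ ≤ _ := by
          gcongr 2 * (?_ * _)
          exact Real.rpow_le_rpow_of_nonpos hb hba (by linarith)
  have h4 : b ^ (-s) * b ^ (-s) ≤ 4 * a ^ (-(2 * s)) := by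
    rw [← Real.rpow_add hb]
    calc b ^ (-s + -s) = b ^ (-(2 * s)) := by congr 1; ring
      _ ≤ (a / 2) ^ (-(2 * s)) :=
        Real.rpow_le_rpow_of_nonpos (by linarith) (by linarith) (by linarith)
      _ = a ^ (-(2 * s)) * 2 ^ (2 * s) := by
        rw [Real.div_rpow ha.le (by norm_num), Real.rpow_neg (by norm_num : (0 : ℝ) ≤ 2)]
        field_simp
      _ ≤ a ^ (-(2 * s)) * 2 ^ (2 : ℝ) := by
        gcongr
        · norm_num
        · linarith
      _ = 4 * a ^ (-(2 * s)) := by norm_num; ring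
  have : sideForm g a b c = g c * c ^ 2 * g a + g c * c ^ 2 * g b
      + g c * ((g b - g a) * (b ^ 2 - a ^ 2)) + g a * g b * (a ^ 2 + b ^ 2 - c ^ 2) := by
    unfold sideForm; ring
  rw [this]
  linarith

/-- The gain of a power `1 + s < 2` over the degenerate exponent `2`, for which the form is
the nonnegative `16 Area²`. -/
lemma le_sum_rpow_of_sorted {s a b c : ℝ} (hs₀ : 0 < s) (hs₁ : s < 1)
    (hc : 0 < c) (hcb : c ≤ b) (hba : b ≤ a) (habc : a ≤ b + c) :
    (1 - (1 / 2) ^ ((1 - s) / 2)) * (c ^ (1 + s) * a ^ 2) ≤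
      a ^ (1 + s) * (b ^ 2 + c ^ 2 - a ^ 2) + b ^ (1 + s) * (a ^ 2 + c ^ 2 - b ^ 2)
        + c ^ (1 + s) * (a ^ 2 + b ^ 2 - c ^ 2) := by
  have hb : 0 < b := hc.trans_le hcb
  have ha : 0 < a := hb.trans_le hba
  have hδ₀ : (0 : ℝ) < (1 / 2) ^ ((1 - s) / 2) := by positivity
  have hδ₁ : ((1 : ℝ) / 2) ^ ((1 - s) / 2) ≤ 1 :=
    Real.rpow_le_one (by norm_num) (by norm_num) (by linarith)
  have hγ : a ^ 2 ≤ a ^ 2 + b ^ 2 - c ^ 2 := by nlinarith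
  have hβ : 0 ≤ a ^ 2 + c ^ 2 - b ^ 2 := by nlinarith
  -- If the angle opposite the longest side is not obtuse, all three terms are nonnegative and the
  -- last one suffices.
  by_cases hα : 0 ≤ b ^ 2 + c ^ 2 - a ^ 2
  · calc _ ≤ 1 * (c ^ (1 + s) * a ^ 2) := by gcongr; linarith
      _ ≤ c ^ (1 + s) * (a ^ 2 + b ^ 2 - c ^ 2) := by rw [one_mul]; gcongr
      _ ≤ _ := by
        have : 0 ≤ a ^ (1 + s) * (b ^ 2 + c ^ 2 - a ^ 2) := by positivity
        have : 0 ≤ b ^ (1 + s) * (a ^ 2 + c ^ 2 - b ^ 2) := by positivity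
        linarith
  · push Not at hα
    -- compare each power with the square
    have key : ∀ t, 0 < t → t ^ (1 + s) * (a / t) ^ (-(1 - s)) = t ^ 2 * a ^ (-(1 - s)) := by
      intro t ht
      rw [Real.div_rpow ha.le ht.le, Real.rpow_neg ht.le, div_inv_eq_mul, mul_comm (a ^ _),
        ← mul_assoc, ← Real.rpow_add ht]
      congr 1
      rw [← Real.rpow_natCast]; congr 1; push_cast; ring
    have hpow : a ^ (1 + s) = a ^ 2 * a ^ (-(1 - s)) := by
      rw [← Real.rpow_natCast, ← Real.rpow_add ha]; congr 1; push_cast; ring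
    set q := a ^ (-(1 - s)) with hq
    have hq0 : 0 < q := by positivity
    have hbq : b ^ 2 * q ≤ b ^ (1 + s) := by
      rw [← key b hb]
      have : (a / b) ^ (-(1 - s)) ≤ 1 :=
        Real.rpow_le_one_of_one_le_of_nonpos (by rw [le_div_iff₀ hb]; linarith) (by linarith)
      exact mul_le_of_le_one_right (by positivity) this
    -- In the obtuse case `2c² ≤ b² + c² < a²`, so `a / c ≥ √2`. This gives the strict gain in the
    -- power of `c`, and hence the constant.
    have hcq : c ^ 2 * q ≤ c ^ (1 + s) * (1 / 2) ^ ((1 - s) / 2) := by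
      rw [← key c hc]
      gcongr
      have h2 : (1 / 2 : ℝ) ^ ((1 - s) / 2) = (((1 / 2 : ℝ) ^ (1 / 2 : ℝ)))⁻¹ ^ (-(1 - s)) := by
        rw [← Real.rpow_neg (by norm_num), ← Real.rpow_mul (by norm_num)]; congr 1; ring
      rw [h2]
      refine Real.rpow_le_rpow_of_nonpos (by positivity) ?_ (by linarith)
      rw [← Real.inv_rpow (by norm_num), ← Real.sqrt_eq_rpow]
      refine Real.sqrt_le_iff.2 ⟨by positivity, ?_⟩
      rw [div_pow, le_div_iff₀ (by positivity)]
      nlinarith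
    -- Heron's formula: the left factor times the right factor below is `16 Area²`.
    have harea : 0 ≤ a ^ 2 * (b ^ 2 + c ^ 2 - a ^ 2) + b ^ 2 * (a ^ 2 + c ^ 2 - b ^ 2)
        + c ^ 2 * (a ^ 2 + b ^ 2 - c ^ 2) := by
      have : 0 ≤ ((a + b) ^ 2 - c ^ 2) * (c ^ 2 - (a - b) ^ 2) :=
        mul_nonneg (by nlinarith) (by nlinarith)
      nlinarith
    have e1 := mul_nonneg harea hq0.le
    have e2 := mul_le_mul_of_nonneg_right hbq hβ
    have e3 := mul_le_mul_of_nonneg_right hcq ((sq_nonneg a).trans hγ)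
    have e4 : (1 - (1 / 2) ^ ((1 - s) / 2)) * c ^ (1 + s) * a ^ 2 ≤
        (1 - (1 / 2) ^ ((1 - s) / 2)) * c ^ (1 + s) * (a ^ 2 + b ^ 2 - c ^ 2) := by
      gcongr
    rw [hpow]
    linarith

lemma le_sideForm_of_sorted {s ε₁ ε₂ a b c : ℝ} (hs₀ : 0 < s) (hs₁ : s < 1)
    (hε : 0 < ε₁) (hc : ε₁ < c) (hcb : c ≤ b) (hba : b ≤ a) (habc : a ≤ b + c) (ha₂ : a ≤ ε₂) :
    (1 - (1 / 2) ^ ((1 - s) / 2)) * a ^ (-(2 * s)) ≤ sideForm (truncProfile s ε₁ ε₂) a b c := by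
  have hc0 : 0 < c := hε.trans hc
  have hb : 0 < b := hc0.trans_le hcb
  have ha : 0 < a := hb.trans_le hba
  have hδ₁ : ((1 : ℝ) / 2) ^ ((1 - s) / 2) ≤ 1 :=
    Real.rpow_le_one (by norm_num) (by norm_num) (by linarith)
  have key := le_sum_rpow_of_sorted hs₀ hs₁ hc0 hcb hba habc
  have ga : truncProfile s ε₁ ε₂ a = (a ^ (1 + s))⁻¹ := if_pos ⟨by linarith, by linarith⟩
  have gb : truncProfile s ε₁ ε₂ b = (b ^ (1 + s))⁻¹ := if_pos ⟨by linarith, by linarith⟩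
  have gc : truncProfile s ε₁ ε₂ c = (c ^ (1 + s))⁻¹ := if_pos ⟨by linarith, by linarith⟩
  have hA : 0 < a ^ (1 + s) := by positivity
  have hB : 0 < b ^ (1 + s) := by positivity
  have hC : 0 < c ^ (1 + s) := by positivity
  have hBA : b ^ (1 + s) ≤ a ^ (1 + s) := by gcongr
  have hpow : a ^ (-(2 * s)) = a ^ 2 / (a ^ (1 + s) * a ^ (1 + s)) := by
    rw [eq_div_iff (by positivity), ← Real.rpow_add ha, ← Real.rpow_add ha, ← Real.rpow_natCast]
    congr 1; push_cast; ring
  have hform : sideForm (truncProfile s ε₁ ε₂) a b c =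
      (a ^ (1 + s) * (b ^ 2 + c ^ 2 - a ^ 2) + b ^ (1 + s) * (a ^ 2 + c ^ 2 - b ^ 2)
        + c ^ (1 + s) * (a ^ 2 + b ^ 2 - c ^ 2)) / (a ^ (1 + s) * b ^ (1 + s) * c ^ (1 + s)) := by
    rw [sideForm, ga, gb, gc]
    field_simp
  rw [hform, le_div_iff₀ (by positivity)]
  refine le_trans ?_ key
  rw [mul_assoc]
  refine mul_le_mul_of_nonneg_left ?_ (by linarith)
  rw [hpow, div_mul_eq_mul_div, div_le_iff₀ (by positivity)]
  have : 0 ≤ a ^ 2 * a ^ (1 + s) * c ^ (1 + s) := by positivity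
  nlinarith

/-- When the shortest side is cut off, only the product at the vertex opposite to it survives, and
the angle there is acute. The bound `a ≤ ε₂` matters: if just the longest side were cut off, the
surviving product could belong to an obtuse angle. -/
lemma sideForm_nonneg_of_sorted {s ε₁ ε₂ a b c : ℝ} (hs₀ : 0 < s) (hs₁ : s < 1)
    (hε : 0 < ε₁) (hc0 : 0 ≤ c) (hcb : c ≤ b) (hba : b ≤ a) (habc : a ≤ b + c) (ha₂ : a ≤ ε₂) :
    0 ≤ sideForm (truncProfile s ε₁ ε₂) a b c := by
  by_cases hc : ε₁ < c
  · refine le_trans ?_ (le_sideForm_of_sorted hs₀ hs₁ hε hc hcb hba habc ha₂)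
    have hδ₁ : ((1 : ℝ) / 2) ^ ((1 - s) / 2) ≤ 1 :=
      Real.rpow_le_one (by norm_num) (by norm_num) (by linarith)
    exact mul_nonneg (by linarith) (Real.rpow_nonneg (by linarith) _)
  · have : truncProfile s ε₁ ε₂ c = 0 := by simp [truncProfile, hc]
    rw [sideForm, this]
    have ga : 0 ≤ truncProfile s ε₁ ε₂ a := truncProfile_nonneg hε
    have gb : 0 ≤ truncProfile s ε₁ ε₂ b := truncProfile_nonneg hε
    have : 0 ≤ a ^ 2 + b ^ 2 - c ^ 2 := by nlinarith
    have := mul_nonneg (mul_nonneg ga gb) this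
    linarith

lemma sideForm_swap_left (g : ℝ → ℝ) (a b c : ℝ) : sideForm g a b c = sideForm g b a c := by
  unfold sideForm; ring

lemma sideForm_swap_right (g : ℝ → ℝ) (a b c : ℝ) : sideForm g a b c = sideForm g a c b := by
  unfold sideForm; ring

/-- A symmetric statement about the sides of a triangle may be checked on ordered sides. -/
lemma triangle_induction {p : ℝ → ℝ → ℝ → Prop} (hl : ∀ a b c, p a b c → p b a c)
    (hr : ∀ a b c, p a b c → p a c b)
    (h : ∀ a b c, 0 ≤ c → c ≤ b → b ≤ a → a ≤ b + c → p a b c) {a b c : ℝ}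
    (ha : 0 ≤ a) (hb : 0 ≤ b) (hc : 0 ≤ c) (h₁ : a ≤ b + c) (h₂ : b ≤ a + c) (h₃ : c ≤ a + b) :
    p a b c := by
  rcases le_total a b with hab | hab <;> rcases le_total b c with hbc | hbc <;>
    rcases le_total a c with hac | hac
  · exact hl _ _ _ (hr _ _ _ (hl _ _ _ (h c b a ha hab hbc (by linarith))))
  · exact hl _ _ _ (hr _ _ _ (hl _ _ _ (h c b a ha hab hbc (by linarith))))
  · exact hl _ _ _ (hr _ _ _ (h b c a ha hac hbc (by linarith)))
  · exact hl _ _ _ (h b a c hc hac hab (by linarith))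
  · exact hr _ _ _ (hl _ _ _ (h c a b hb hab hac (by linarith)))
  · exact hr _ _ _ (h a c b hb hbc hac (by linarith))
  · exact h a b c hc hbc hab (by linarith)
  · exact h a b c hc hbc hab (by linarith)

lemma sideForm_le {s ε₁ ε₂ a b c : ℝ} (hs₀ : 0 < s) (hs₁ : s < 1) (hε : 0 < ε₁)
    (ha : 0 ≤ a) (hb : 0 ≤ b) (hc : 0 ≤ c) (h₁ : a ≤ b + c) (h₂ : b ≤ a + c) (h₃ : c ≤ a + b)
    (hpos : 0 < max a (max b c)) :
    sideForm (truncProfile s ε₁ ε₂) a b c ≤ 16 * max a (max b c) ^ (-(2 * s)) := by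
  revert hpos
  refine triangle_induction (p := fun a b c => 0 < max a (max b c) →
    sideForm (truncProfile s ε₁ ε₂) a b c ≤ 16 * max a (max b c) ^ (-(2 * s)))
    (fun a b c h => ?_) (fun a b c h => ?_) (fun a b c hc hcb hba habc => ?_) ha hb hc h₁ h₂ h₃
  · rwa [max_left_comm, sideForm_swap_left]
  · rwa [max_comm c b, sideForm_swap_right]
  · rw [max_eq_left hcb, max_eq_left hba]
    intro ha
    exact sideForm_le_of_sorted hs₀ hs₁ hε hc hcb hba habc (by linarith)

lemma sideForm_nonneg {s ε₁ ε₂ a b c : ℝ} (hs₀ : 0 < s) (hs₁ : s < 1) (hε : 0 < ε₁)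
    (ha : 0 ≤ a) (hb : 0 ≤ b) (hc : 0 ≤ c) (h₁ : a ≤ b + c) (h₂ : b ≤ a + c) (h₃ : c ≤ a + b)
    (hle : max a (max b c) ≤ ε₂) :
    0 ≤ sideForm (truncProfile s ε₁ ε₂) a b c := by
  revert hle
  refine triangle_induction (p := fun a b c => max a (max b c) ≤ ε₂ →
    0 ≤ sideForm (truncProfile s ε₁ ε₂) a b c)
    (fun a b c h => ?_) (fun a b c h => ?_) (fun a b c hc hcb hba habc => ?_) ha hb hc h₁ h₂ h₃
  · rwa [max_left_comm, sideForm_swap_left]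
  · rwa [max_comm c b, sideForm_swap_right]
  · rw [max_eq_left hcb, max_eq_left hba]
    exact sideForm_nonneg_of_sorted hs₀ hs₁ hε hc hcb hba habc

lemma le_sideForm {s ε₁ ε₂ a b c : ℝ} (hs₀ : 0 < s) (hs₁ : s < 1) (hε : 0 < ε₁)
    (ha : 0 ≤ a) (hb : 0 ≤ b) (hc : 0 ≤ c) (h₁ : a ≤ b + c) (h₂ : b ≤ a + c) (h₃ : c ≤ a + b)
    (hlt : ε₁ < min a (min b c)) (hle : max a (max b c) ≤ ε₂) :
    (1 - (1 / 2) ^ ((1 - s) / 2)) * max a (max b c) ^ (-(2 * s)) ≤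
      sideForm (truncProfile s ε₁ ε₂) a b c := by
  revert hlt hle
  refine triangle_induction (p := fun a b c => ε₁ < min a (min b c) → max a (max b c) ≤ ε₂ →
    (1 - (1 / 2) ^ ((1 - s) / 2)) * max a (max b c) ^ (-(2 * s)) ≤
      sideForm (truncProfile s ε₁ ε₂) a b c)
    (fun a b c h => ?_) (fun a b c h => ?_) (fun a b c hc hcb hba habc => ?_) ha hb hc h₁ h₂ h₃
  · rwa [max_left_comm, min_left_comm, sideForm_swap_left]
  · rwa [max_comm c b, min_comm c b, sideForm_swap_right]
  · rw [max_eq_left hcb, max_eq_left hba, min_eq_right hcb, min_eq_right (hcb.trans hba)]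
    exact fun h => le_sideForm_of_sorted hs₀ hs₁ hε h hcb hba habc

/-! ### Cyclic sums of the vector kernel -/

/-- The Riesz kernel restricted to the shell `ε₁ < |v| ≤ ε₂`. -/
noncomputable def truncKernel {E : Type*} [NormedAddCommGroup E] [NormedSpace ℝ E]
    (s ε₁ ε₂ : ℝ) (v : E) : E :=
  truncProfile s ε₁ ε₂ ‖v‖ • v

/-- The integrand of the expanded square `|∫ k (y - x) dμ(y)|²`, as a function of `(x, y, z)`. -/
noncomputable def kernelProd {E : Type*} [NormedAddCommGroup E] [InnerProductSpace ℝ E]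
    (k : E → E) (p : E × E × E) : ℝ :=
  inner ℝ (k (p.2.1 - p.1)) (k (p.2.2 - p.1))

/-- The sum of `kernelProd` over the cyclic rotations of the triple. -/
noncomputable def kernelSum {E : Type*} [NormedAddCommGroup E] [InnerProductSpace ℝ E]
    (k : E → E) (p : E × E × E) : ℝ :=
  kernelProd k p + kernelProd k (p.2.1, p.2.2, p.1) + kernelProd k (p.2.2, p.1, p.2.1)

lemma triangle_sides {E : Type*} [NormedAddCommGroup E] (x y z : E) :
    ‖y - z‖ ≤ ‖z - x‖ + ‖y - x‖ ∧
    ‖z - x‖ ≤ ‖y - z‖ + ‖y - x‖ ∧    ‖y - x‖ ≤ ‖y - z‖ + ‖z - x‖ := by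
  have h₁ := norm_sub_le (y - x) (z - x)
  have h₂ := norm_sub_le (y - x) (y - z)
  have h₃ := norm_add_le (y - z) (z - x)
  simp only [sub_sub_sub_cancel_right, sub_sub_sub_cancel_left, sub_add_sub_cancel] at h₁ h₂ h₃
  exact ⟨by linarith, by linarith, by linarith⟩

/-- The cyclic rotation `(x, y, z) ↦ (y, z, x)`. -/
def rotateTriple (E : Type*) [MeasurableSpace E] : E × E × E ≃ᵐ E × E × E :=
  MeasurableEquiv.prodComm.trans MeasurableEquiv.prodAssoc

lemma measurePreserving_rotateTriple {E : Type*} [MeasurableSpace E]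
    (ν : Measure E) [SFinite ν] :
    MeasurePreserving (rotateTriple E) (ν.prod (ν.prod ν)) (ν.prod (ν.prod ν)) :=
  (measurePreserving_prodAssoc ν ν ν).comp Measure.measurePreserving_swap

section Pointwise

variable {E : Type*} [NormedAddCommGroup E] [InnerProductSpace ℝ E]

lemma two_mul_inner_truncKernel (s ε₁ ε₂ : ℝ) (u v : E) :
    2 * inner ℝ (truncKernel s ε₁ ε₂ u) (truncKernel s ε₁ ε₂ v) =
      truncProfile s ε₁ ε₂ ‖u‖ * truncProfile s ε₁ ε₂ ‖v‖ *
        (‖u‖ ^ 2 + ‖v‖ ^ 2 - ‖u - v‖ ^ 2) := by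
  rw [truncKernel, truncKernel, real_inner_smul_left, real_inner_smul_right,
    norm_sub_sq_real]
  ring

lemma two_mul_kernelSum (s ε₁ ε₂ : ℝ) (x y z : E) :
    2 * kernelSum (truncKernel s ε₁ ε₂) (x, y, z) =
      sideForm (truncProfile s ε₁ ε₂) ‖y - z‖ ‖z - x‖ ‖y - x‖ := by
  simp only [kernelSum, kernelProd, mul_add, two_mul_inner_truncKernel, sub_sub_sub_cancel_right,
    norm_sub_rev x y, norm_sub_rev x z, norm_sub_rev z y]
  unfold sideForm
  ring

lemma kernelSum_le {s ε₁ ε₂ : ℝ} (hs₀ : 0 < s) (hs₁ : s < 1) (hε : 0 < ε₁) (x y z : E)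
    (hpos : 0 < max ‖y - x‖ ‖z - x‖) :
    kernelSum (truncKernel s ε₁ ε₂) (x, y, z) ≤ 8 * max ‖y - x‖ ‖z - x‖ ^ (-(2 * s)) := by
  obtain ⟨h₁, h₂, h₃⟩ := triangle_sides x y z
  have hle : max ‖y - x‖ ‖z - x‖ ≤ max ‖y - z‖ (max ‖z - x‖ ‖y - x‖) := by
    rw [max_comm ‖y - x‖]; exact le_max_right _ _
  have := sideForm_le (ε₂ := ε₂) hs₀ hs₁ hε (norm_nonneg (y - z)) (norm_nonneg (z - x))
    (norm_nonneg (y - x)) h₁ h₂ h₃ (hpos.trans_le hle)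
  rw [← two_mul_kernelSum] at this
  have h := Real.rpow_le_rpow_of_nonpos hpos hle (by linarith : -(2 * s) ≤ 0)
  linarith

lemma kernelSum_nonneg {s ε₁ ε₂ : ℝ} (hs₀ : 0 < s) (hs₁ : s < 1) (hε : 0 < ε₁) (x y z : E)
    (hyz : ‖y - z‖ ≤ ε₂) (hzx : ‖z - x‖ ≤ ε₂) (hyx : ‖y - x‖ ≤ ε₂) :
    0 ≤ kernelSum (truncKernel s ε₁ ε₂) (x, y, z) := by
  obtain ⟨h₁, h₂, h₃⟩ := triangle_sides x y z
  have := sideForm_nonneg (ε₂ := ε₂) hs₀ hs₁ hε (norm_nonneg (y - z)) (norm_nonneg (z - x))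
    (norm_nonneg (y - x)) h₁ h₂ h₃ (max_le hyz (max_le hzx hyx))
  rw [← two_mul_kernelSum] at this
  linarith

/-- The longest side is at most twice the larger of the two sides at `x`. This loses a factor `2 ^
(2s) ≤ 4`, and the factor `2` in `two_mul_kernelSum` accounts for the rest of the `8`. -/
lemma le_kernelSum {s ε₁ ε₂ : ℝ} (hs₀ : 0 < s) (hs₁ : s < 1) (hε : 0 < ε₁) (x y z : E)
    (hyz : ‖y - z‖ ≤ ε₂) (hzx : ‖z - x‖ ≤ ε₂) (hyx : ‖y - x‖ ≤ ε₂)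
    (hyz' : ε₁ < ‖y - z‖) (hzx' : ε₁ < ‖z - x‖) (hyx' : ε₁ < ‖y - x‖) :
    (1 - (1 / 2) ^ ((1 - s) / 2)) / 8 * max ‖y - x‖ ‖z - x‖ ^ (-(2 * s)) ≤
      kernelSum (truncKernel s ε₁ ε₂) (x, y, z) := by
  obtain ⟨h₁, h₂, h₃⟩ := triangle_sides x y z
  have := le_sideForm (ε₂ := ε₂) hs₀ hs₁ hε (norm_nonneg (y - z)) (norm_nonneg (z - x))
    (norm_nonneg (y - x)) h₁ h₂ h₃ (lt_min hyz' (lt_min hzx' hyx')) (max_le hyz (max_le hzx hyx))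
  rw [← two_mul_kernelSum] at this
  have hδ₁ : ((1 : ℝ) / 2) ^ ((1 - s) / 2) ≤ 1 :=
    Real.rpow_le_one (by norm_num) (by norm_num) (by linarith)
  set M := max ‖y - x‖ ‖z - x‖ with hM
  have hyM : ‖y - x‖ ≤ M := le_max_left _ _
  have hzM : ‖z - x‖ ≤ M := le_max_right _ _
  have hM0 : 0 < M := by linarith
  have hL : max ‖y - z‖ (max ‖z - x‖ ‖y - x‖) ≤ 2 * M :=
    max_le (by linarith) (max_le (by linarith) (by linarith))
  have hL0 : 0 < max ‖y - z‖ (max ‖z - x‖ ‖y - x‖) :=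
    lt_max_of_lt_left (hε.trans hyz')
  have h := Real.rpow_le_rpow_of_nonpos hL0 hL (by linarith : -(2 * s) ≤ 0)
  have h4 : M ^ (-(2 * s)) ≤ 4 * (2 * M) ^ (-(2 * s)) := by
    rw [Real.mul_rpow (by norm_num) hM0.le, ← mul_assoc]
    refine le_mul_of_one_le_left (by positivity) ?_
    calc (1 : ℝ) = 4 * 2 ^ (-2 : ℝ) := by norm_num
      _ ≤ 4 * 2 ^ (-(2 * s)) := by
        gcongr
        · norm_num
        · linarith
  have h5 := mul_le_mul_of_nonneg_left (h4.trans (mul_le_mul_of_nonneg_left h (by norm_num)))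
    (by linarith : 0 ≤ 1 - (1 / 2 : ℝ) ^ ((1 - s) / 2))
  linarith

lemma enorm_truncKernel_le {s ε₁ ε₂ : ℝ} (hs₀ : 0 < s) (hε : 0 < ε₁) (x y : E) :
    ‖truncKernel s ε₁ ε₂ (y - x)‖ₑ ≤
      (Metric.closedBall x ε₂).indicator (fun _ => ENNReal.ofReal (ε₁ ^ (-s))) y := by
  by_cases h : ε₁ < ‖y - x‖ ∧ ‖y - x‖ ≤ ε₂
  · rw [indicator_of_mem (by rw [Metric.mem_closedBall, dist_eq_norm]; exact h.2), ← ofReal_norm]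
    refine ENNReal.ofReal_le_ofReal ?_
    have h0 := hε.trans h.1
    rw [truncKernel, norm_smul, Real.norm_of_nonneg (truncProfile_nonneg hε)]
    exact (truncProfile_mul_le h0).trans
      (Real.rpow_le_rpow_of_nonpos hε h.1.le (by linarith))
  · simp [truncKernel, truncProfile, h]

end Pointwise

/-! ### Symmetrization of the squared integral -/

section Symmetrization

variable {E : Type*} [NormedAddCommGroup E] [InnerProductSpace ℝ E] [MeasurableSpace E]
  [BorelSpace E] [SecondCountableTopology E]

@[fun_prop]
lemma measurable_truncProfile (s ε₁ ε₂ : ℝ) : Measurable (truncProfile s ε₁ ε₂) := by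
  unfold truncProfile
  refine Measurable.ite ?_ (by fun_prop) (by fun_prop)
  exact measurableSet_Ioc

@[fun_prop]
lemma measurable_truncKernel (s ε₁ ε₂ : ℝ) : Measurable (truncKernel s ε₁ ε₂ : E → E) := by
  unfold truncKernel
  fun_prop

lemma measurable_kernelProd {k : E → E} (hk : Measurable k) : Measurable (kernelProd k) := by
  unfold kernelProd
  fun_prop

lemma lintegral_enorm_kernelProd_lt_top {k : E → E} (hk : Measurable k) {C : ℝ≥0∞} (hC : C ≠ ∞)
    {R : ℝ} (hkC : ∀ x y, ‖k (y - x)‖ₑ ≤ (Metric.closedBall x R).indicator (fun _ => C) y)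
    (ν : Measure E) [SFinite ν] (hν : ∫⁻ x, ν (Metric.closedBall x R) ^ 2 ∂ν < ∞) :
    ∫⁻ p, ‖kernelProd k p‖ₑ ∂(ν.prod (ν.prod ν)) < ∞ := by
  calc ∫⁻ p, ‖kernelProd k p‖ₑ ∂(ν.prod (ν.prod ν))
      ≤ ∫⁻ p, ‖k (p.2.1 - p.1)‖ₑ * ‖k (p.2.2 - p.1)‖ₑ ∂(ν.prod (ν.prod ν)) :=
        lintegral_mono fun p => by
          rw [← ofReal_norm, ← ofReal_norm, ← ofReal_norm, ← ENNReal.ofReal_mul (norm_nonneg _)]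
          exact ENNReal.ofReal_le_ofReal (norm_inner_le_norm _ _)
    _ = ∫⁻ x, (∫⁻ y, ‖k (y - x)‖ₑ ∂ν) ^ 2 ∂ν := by
        rw [lintegral_prod _ (by fun_prop)]
        refine lintegral_congr fun x => ?_
        rw [lintegral_prod_mul (f := fun y => ‖k (y - x)‖ₑ) (g := fun z => ‖k (z - x)‖ₑ)
          (by fun_prop) (by fun_prop), sq]
    _ ≤ ∫⁻ x, C ^ 2 * ν (Metric.closedBall x R) ^ 2 ∂ν := by
        gcongr with x
        rw [← mul_pow]
        gcongr
        refine (lintegral_mono (hkC x)).trans_eq ?_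
        rw [lintegral_indicator Metric.isClosed_closedBall.measurableSet, setLIntegral_const]
    _ < ∞ := by
        rw [lintegral_const_mul' _ _ (by finiteness)]
        exact ENNReal.mul_lt_top (by finiteness) hν

/-- Symmetrization of the square of an integral operator. -/
lemma integrable_kernelSum_and_ofReal_integral [ProperSpace E] {k : E → E} (hk : Measurable k)
    {C : ℝ≥0∞}
    (hC : C ≠ ∞) {R : ℝ} (hkC : ∀ x y, ‖k (y - x)‖ₑ ≤
      (Metric.closedBall x R).indicator (fun _ => C) y)
    (ν : Measure E) [IsLocallyFiniteMeasure ν]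
    (hν : ∫⁻ x, ν (Metric.closedBall x R) ^ 2 ∂ν < ∞) :
    Integrable (kernelSum k) (ν.prod (ν.prod ν)) ∧
      ENNReal.ofReal (∫ p, kernelSum k p ∂(ν.prod (ν.prod ν))) =
        3 * ∫⁻ x, ‖∫ y, k (y - x) ∂ν‖ₑ ^ 2 ∂ν := by
  have hF : Integrable (kernelProd k) (ν.prod (ν.prod ν)) :=
    ⟨(measurable_kernelProd hk).aestronglyMeasurable,
      lintegral_enorm_kernelProd_lt_top hk hC hkC ν hν⟩
  have hrot := measurePreserving_rotateTriple ν
  have hemb := (rotateTriple E).measurableEmbedding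
  have hF₁ : Integrable (fun p => kernelProd k (rotateTriple E p)) (ν.prod (ν.prod ν)) :=
    (hrot.integrable_comp_emb hemb).2 hF
  have hF₂ : Integrable (fun p => kernelProd k (rotateTriple E (rotateTriple E p)))
      (ν.prod (ν.prod ν)) := (hrot.integrable_comp_emb hemb).2 hF₁
  -- Rotation preserves the product measure, so the three summands have equal integrals.
  have hI₁ : ∫ p, kernelProd k (rotateTriple E p) ∂(ν.prod (ν.prod ν)) =
      ∫ p, kernelProd k p ∂(ν.prod (ν.prod ν)) := hrot.integral_comp hemb _
  have hI₂ : ∫ p, kernelProd k (rotateTriple E (rotateTriple E p)) ∂(ν.prod (ν.prod ν)) =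
      ∫ p, kernelProd k p ∂(ν.prod (ν.prod ν)) := (hrot.integral_comp hemb _).trans hI₁
  have hsum : kernelSum k = fun p => kernelProd k p + kernelProd k (rotateTriple E p) +
      kernelProd k (rotateTriple E (rotateTriple E p)) := rfl
  refine ⟨hsum ▸ (hF.add hF₁).add hF₂, ?_⟩
  have hkint : ∀ x, Integrable (fun y => k (y - x)) ν := fun x => by
    refine ⟨(hk.comp (measurable_sub_const x)).aestronglyMeasurable,
      (lintegral_mono (hkC x)).trans_lt ?_⟩
    rw [lintegral_indicator Metric.isClosed_closedBall.measurableSet, setLIntegral_const]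
    exact ENNReal.mul_lt_top hC.lt_top measure_closedBall_lt_top
  have hinner : ∀ x, ∫ q, kernelProd k (x, q) ∂(ν.prod ν) = ‖∫ y, k (y - x) ∂ν‖ ^ 2 := by
    intro x
    have hint : Integrable (fun q : E × E => kernelProd k (x, q)) (ν.prod ν) := by
      refine ((hkint x).norm.mul_prod (hkint x).norm).mono'
        ((measurable_kernelProd hk).comp measurable_prodMk_left).aestronglyMeasurable ?_
      exact Eventually.of_forall fun q => norm_inner_le_norm _ _
    rw [integral_prod _ hint, ← real_inner_self_eq_norm_sq]
    simp only [kernelProd]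
    simp_rw [integral_inner (hkint x)]
    rw [← integral_inner (hkint x)]
    simp_rw [real_inner_comm (∫ y, k (y - x) ∂ν)]
  have hsq : Integrable (fun x => ‖∫ y, k (y - x) ∂ν‖ ^ 2) ν := by
    simpa only [hinner] using hF.integral_prod_left
  have hI : ∫ p, kernelProd k p ∂(ν.prod (ν.prod ν)) = ∫ x, ‖∫ y, k (y - x) ∂ν‖ ^ 2 ∂ν := by
    rw [integral_prod _ hF]
    simp_rw [hinner]
  have htot : ∫ p, kernelSum k p ∂(ν.prod (ν.prod ν)) =
      3 * ∫ x, ‖∫ y, k (y - x) ∂ν‖ ^ 2 ∂ν := by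
    rw [hsum]
    have := integral_add (hF.add hF₁) hF₂
    simp only [Pi.add_apply] at this
    rw [this, integral_add hF hF₁, hI₁, hI₂, hI]
    ring
  rw [htot, ENNReal.ofReal_mul (by norm_num), ENNReal.ofReal_ofNat,
    ofReal_integral_eq_lintegral_ofReal hsq (Eventually.of_forall fun x => by positivity)]
  simp_rw [ENNReal.ofReal_pow (norm_nonneg _), ofReal_norm]

end Symmetrization

/-! ### The Wolff energy as a triple energy -/

/-- The kernel `max(|y - x|, |z - x|)^(-2s)` of the triple energy, equal to `∞` for `x = y = z`. -/
noncomputable def tripleKernel {E : Type*} [NormedAddCommGroup E] (s : ℝ) (p : E × E × E) : ℝ≥0∞ :=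
  ENNReal.ofReal (max ‖p.2.1 - p.1‖ ‖p.2.2 - p.1‖) ^ (-(2 * s))

/-- The triple energy `∫∫∫ max(|y - x|, |z - x|)^(-2s) dμ(x) dμ(y) dμ(z)`. -/
noncomputable def tripleEnergy {E : Type*} [NormedAddCommGroup E] [MeasurableSpace E] (s : ℝ)
    (μ : Measure E) : ℝ≥0∞ :=
  ∫⁻ p, tripleKernel s p ∂(μ.prod (μ.prod μ))

lemma ENNReal.rpow_neg_le_rpow_neg {a b : ℝ≥0∞} {t : ℝ} (ht : 0 ≤ t) (h : a ≤ b) :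
    b ^ (-t) ≤ a ^ (-t) := by
  rw [ENNReal.rpow_neg, ENNReal.rpow_neg]
  gcongr

@[fun_prop]
lemma measurable_tripleKernel {E : Type*} [NormedAddCommGroup E] [MeasurableSpace E]
    [BorelSpace E] [SecondCountableTopology E] (s : ℝ) :
    Measurable (tripleKernel s : E × E × E → ℝ≥0∞) := by
  unfold tripleKernel
  fun_prop

/-- The case `m = 0`, where both sides are `∞`, covers triples `x = y = z`, so the energy identity
holds for measures with atoms too. It is obtained from positive `m` by letting `m` tend to `0`. -/
lemma lintegral_Ioi_rpow {s : ℝ} (hs : 0 < s) {m : ℝ} (hm : 0 ≤ m) :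
    ENNReal.ofReal (2 * s) * ∫⁻ r in Ioi m, ENNReal.ofReal (r ^ (-(2 * s) - 1)) =
      ENNReal.ofReal m ^ (-(2 * s)) := by
  have hpos : ∀ {m : ℝ}, 0 < m →
      ENNReal.ofReal (2 * s) * ∫⁻ r in Ioi m, ENNReal.ofReal (r ^ (-(2 * s) - 1)) =
      ENNReal.ofReal m ^ (-(2 * s)) := by
    intro m hm
    rw [← ofReal_integral_eq_lintegral_ofReal (integrableOn_Ioi_rpow_of_lt (by linarith) hm)
      ((ae_restrict_mem measurableSet_Ioi).mono fun r hr => Real.rpow_nonneg (hm.trans hr).le _),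
      integral_Ioi_rpow_of_lt (by linarith) hm, ← ENNReal.ofReal_mul (by positivity),
      ENNReal.ofReal_rpow_of_pos hm]
    congr 1
    rw [sub_add_cancel]
    field_simp
  rcases hm.eq_or_lt with rfl | hm
  · rw [ENNReal.ofReal_zero, ENNReal.zero_rpow_of_neg (by linarith)]
    have hlim : Tendsto (fun n : ℕ => ENNReal.ofReal (1 / ((n : ℝ) + 1)) ^ (-(2 * s))) atTop
        (nhds ((ENNReal.ofReal 0) ^ (-(2 * s)))) :=
      (ENNReal.continuous_rpow_const.tendsto _).comp
        ((ENNReal.continuous_ofReal.tendsto _).comp tendsto_one_div_add_atTop_nhds_zero_nat)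
    rw [ENNReal.ofReal_zero, ENNReal.zero_rpow_of_neg (by linarith)] at hlim
    refine top_le_iff.1 (le_of_tendsto' hlim fun n => ?_)
    rw [← hpos (by positivity)]
    gcongr
    positivity
  · exact hpos hm

lemma ofReal_mul_wolffPotential {d : ℕ} {s : ℝ} (hs : 0 < s)
    (μ : Measure (EuclideanSpace ℝ (Fin d))) [SFinite μ] (x : EuclideanSpace ℝ (Fin d)) :
    ENNReal.ofReal (2 * s) * wolffPotential s μ x =
      ∫⁻ q, tripleKernel s (x, q) ∂(μ.prod μ) := by
  set m : EuclideanSpace ℝ (Fin d) × EuclideanSpace ℝ (Fin d) → ℝ :=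
    fun q => max ‖q.1 - x‖ ‖q.2 - x‖ with hm
  have hmm : Measurable m := by fun_prop
  have hball : ∀ r, μ (Metric.ball x r) ^ 2 = (μ.prod μ) {q | m q < r} := by
    intro r
    rw [sq, ← Measure.prod_prod]
    congr 1
    ext q
    simp [hm, dist_eq_norm]
  have h₁ : wolffPotential s μ x = ∫⁻ r in Ioi (0 : ℝ), ∫⁻ q,
      {a : ℝ × _ | m a.2 < a.1}.indicator (fun a => ENNReal.ofReal (a.1 ^ (-(2 * s) - 1))) (r, q)
        ∂(μ.prod μ) := by
    refine setLIntegral_congr_fun measurableSet_Ioi fun r (hr : 0 < r) => ?_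
    have : ∀ q, {a : ℝ × _ | m a.2 < a.1}.indicator
        (fun a => ENNReal.ofReal (a.1 ^ (-(2 * s) - 1))) (r, q) =
        {q | m q < r}.indicator (fun _ => ENNReal.ofReal (r ^ (-(2 * s) - 1))) q := fun q => rfl
    simp_rw [this]
    rw [lintegral_indicator (measurableSet_lt hmm measurable_const), setLIntegral_const, ← hball,
      density, ENNReal.div_eq_inv_mul, ENNReal.div_eq_inv_mul, mul_pow, ← mul_assoc]
    congr 1
    have hrs : 0 < r ^ s := by positivity
    rw [← ENNReal.ofReal_inv_of_pos hr, ← ENNReal.ofReal_inv_of_pos hrs,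
      ← ENNReal.ofReal_pow (by positivity), ← ENNReal.ofReal_mul (by positivity)]
    congr 1
    rw [← Real.rpow_neg_one r, ← Real.rpow_neg hr.le, ← Real.rpow_natCast, ← Real.rpow_mul hr.le,
      ← Real.rpow_add hr]
    congr 1
    push_cast
    ring
  have hmeas : Measurable ({a : ℝ × (EuclideanSpace ℝ (Fin d) × EuclideanSpace ℝ (Fin d)) |
      m a.2 < a.1}.indicator (fun a => ENNReal.ofReal (a.1 ^ (-(2 * s) - 1)))) :=
    Measurable.indicator (by fun_prop)
      (measurableSet_lt (hmm.comp measurable_snd) measurable_fst)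
  rw [h₁, lintegral_lintegral_swap (f := fun r q => {a : ℝ × _ | m a.2 < a.1}.indicator
      (fun a => ENNReal.ofReal (a.1 ^ (-(2 * s) - 1))) (r, q)) hmeas.aemeasurable,
    ← lintegral_const_mul' _ _ (by finiteness)]
  refine lintegral_congr fun q => ?_
  have hmq : 0 ≤ m q := le_max_of_le_left (norm_nonneg _)
  rw [tripleKernel, ← lintegral_Ioi_rpow hs hmq]
  congr 1
  have : ∀ r, {a : ℝ × _ | m a.2 < a.1}.indicator
        (fun a => ENNReal.ofReal (a.1 ^ (-(2 * s) - 1))) (r, q) =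
        (Ioi (m q)).indicator (fun r => ENNReal.ofReal (r ^ (-(2 * s) - 1))) r := fun q => rfl
  simp_rw [this]
  rw [lintegral_indicator measurableSet_Ioi, Measure.restrict_restrict measurableSet_Ioi,
    inter_eq_self_of_subset_left (Ioi_subset_Ioi hmq)]

/-- The Wolff energy is a triple energy. -/
lemma ofReal_mul_wolffEnergy {d : ℕ} {s : ℝ} (hs : 0 < s)
    (μ : Measure (EuclideanSpace ℝ (Fin d))) [SFinite μ] :
    ENNReal.ofReal (2 * s) * wolffEnergy s μ = tripleEnergy s μ := by
  rw [wolffEnergy, ← lintegral_const_mul' _ _ (by finiteness), tripleEnergy,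
    lintegral_prod _ (by fun_prop)]
  exact lintegral_congr fun x => ofReal_mul_wolffPotential hs μ x

/-- On pairs in the closed ball about `x` the triple kernel is at least `R ^ (-2s)`. This supplies
the integrability that symmetrization needs. -/
lemma lintegral_measure_closedBall_sq_lt_top {E : Type*} [NormedAddCommGroup E]
    [MeasurableSpace E] [BorelSpace E] [SecondCountableTopology E] {s : ℝ} (hs : 0 < s)
    (μ : Measure E) [SFinite μ] (hμ : tripleEnergy s μ < ∞) {R : ℝ} (hR : 0 < R) :
    ∫⁻ x, μ (Metric.closedBall x R) ^ 2 ∂μ < ∞ := by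
  have key : ENNReal.ofReal R ^ (-(2 * s)) * ∫⁻ x, μ (Metric.closedBall x R) ^ 2 ∂μ ≤
      tripleEnergy s μ := by
    rw [tripleEnergy, lintegral_prod _ (by fun_prop), ENNReal.ofReal_rpow_of_pos hR,
      ← lintegral_const_mul' _ _ (by finiteness)]
    gcongr with x
    rw [sq, ← Measure.prod_prod, ← setLIntegral_const]
    refine (setLIntegral_mono (by fun_prop) fun q hq => ?_).trans (setLIntegral_le_lintegral _ _)
    rw [← ENNReal.ofReal_rpow_of_pos hR, tripleKernel]
    refine ENNReal.rpow_neg_le_rpow_neg (by linarith) (ENNReal.ofReal_le_ofReal ?_)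
    simpa [dist_eq_norm] using hq
  have h0 : ENNReal.ofReal R ^ (-(2 * s)) ≠ 0 := by
    rw [ENNReal.ofReal_rpow_of_pos hR]
    simp only [ne_eq, ENNReal.ofReal_eq_zero, not_le]
    positivity
  exact ENNReal.lt_top_of_mul_ne_top_right (key.trans_lt hμ).ne h0

/-! ### The upper bound (a) -/

lemma truncRiesz_eq {d : ℕ} (s ε₁ ε₂ : ℝ) (μ : Measure (EuclideanSpace ℝ (Fin d)))
    (x : EuclideanSpace ℝ (Fin d)) :
    truncRiesz s ε₁ ε₂ μ x = ∫ y, truncKernel s ε₁ ε₂ (y - x) ∂μ := by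
  rw [truncRiesz, ← integral_indicator]
  · refine integral_congr_ae (Eventually.of_forall fun y => ?_)
    by_cases h : ε₁ < ‖y - x‖ ∧ ‖y - x‖ ≤ ε₂ <;>
      simp [indicator, truncKernel, truncProfile, rieszKernel, h]
  · have h : Measurable fun y : EuclideanSpace ℝ (Fin d) => ‖y - x‖ := by fun_prop
    exact h measurableSet_Ioc

/-- Symmetrization of the energy of the truncated Riesz transform. -/
lemma integrable_kernelSum_and_three_mul_energy {d : ℕ} {s ε₁ ε₂ : ℝ} (hs₀ : 0 < s) (hε : 0 < ε₁)
    (μ : Measure (EuclideanSpace ℝ (Fin d))) [IsLocallyFiniteMeasure μ]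
    (hμ : ∫⁻ x, μ (Metric.closedBall x ε₂) ^ 2 ∂μ < ∞) :
    Integrable (kernelSum (truncKernel s ε₁ ε₂)) (μ.prod (μ.prod μ)) ∧
      3 * truncRieszEnergy s ε₁ ε₂ μ =
        ENNReal.ofReal (∫ p, kernelSum (truncKernel s ε₁ ε₂) p ∂(μ.prod (μ.prod μ))) := by
  obtain ⟨h₁, h₂⟩ := integrable_kernelSum_and_ofReal_integral (measurable_truncKernel s ε₁ ε₂)
    ENNReal.ofReal_ne_top (fun x y => enorm_truncKernel_le hs₀ hε x y) μ hμ
  refine ⟨h₁, ?_⟩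
  rw [h₂, truncRieszEnergy]
  simp_rw [truncRiesz_eq]

lemma ofReal_integral_le_lintegral_ofReal {α : Type*} [MeasurableSpace α] {μ : Measure α}
    {f : α → ℝ} (hf : Integrable f μ) :
    ENNReal.ofReal (∫ a, f a ∂μ) ≤ ∫⁻ a, ENNReal.ofReal (f a) ∂μ := by
  calc ENNReal.ofReal (∫ a, f a ∂μ) ≤ ENNReal.ofReal (∫ a, max (f a) 0 ∂μ) :=
        ENNReal.ofReal_le_ofReal (integral_mono hf hf.pos_part fun a => le_max_left _ _)
    _ = ∫⁻ a, ENNReal.ofReal (max (f a) 0) ∂μ :=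
        ofReal_integral_eq_lintegral_ofReal hf.pos_part
          (Eventually.of_forall fun a => le_max_right _ _)
    _ = _ := by simp

lemma truncRieszEnergy_le {d : ℕ} {s ε₁ ε₂ : ℝ} (hs₀ : 0 < s) (hs₁ : s < 1) (hε₁ : 0 < ε₁)
    (hε₂ : 0 < ε₂) (μ : Measure (EuclideanSpace ℝ (Fin d))) [IsLocallyFiniteMeasure μ] :
    truncRieszEnergy s ε₁ ε₂ μ ≤ 16 * wolffEnergy s μ := by
  rcases (le_top : wolffEnergy s μ ≤ ∞).eq_or_lt with hW | hW
  · simp [hW]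
  have hT : tripleEnergy s μ < ∞ := by
    rw [← ofReal_mul_wolffEnergy hs₀]; exact ENNReal.mul_lt_top (by finiteness) hW
  obtain ⟨hint, hE⟩ := integrable_kernelSum_and_three_mul_energy (ε₂ := ε₂) hs₀ hε₁ μ
    (lintegral_measure_closedBall_sq_lt_top hs₀ μ hT hε₂)
  have hpt : ∀ p : EuclideanSpace ℝ (Fin d) × EuclideanSpace ℝ (Fin d) × EuclideanSpace ℝ (Fin d),
      ENNReal.ofReal (kernelSum (truncKernel s ε₁ ε₂) p) ≤ 8 * tripleKernel s p := by
    rintro ⟨x, y, z⟩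
    have h0 : 0 ≤ max ‖y - x‖ ‖z - x‖ := le_max_of_le_left (norm_nonneg _)
    rcases h0.eq_or_lt with h | h
    · have : tripleKernel s (x, y, z) = ∞ := by
        rw [tripleKernel, ← h, ENNReal.ofReal_zero, ENNReal.zero_rpow_of_neg (by linarith)]
      rw [this]; simp
    · rw [tripleKernel, ENNReal.ofReal_rpow_of_pos h, ← ENNReal.ofReal_ofNat 8,
        ← ENNReal.ofReal_mul (by norm_num)]
      exact ENNReal.ofReal_le_ofReal (kernelSum_le hs₀ hs₁ hε₁ x y z h)
  calc truncRieszEnergy s ε₁ ε₂ μ ≤ 3 * truncRieszEnergy s ε₁ ε₂ μ :=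
        le_mul_of_one_le_left' (by norm_num)
    _ ≤ ∫⁻ p, 8 * tripleKernel s p ∂(μ.prod (μ.prod μ)) := by
        rw [hE]
        exact (ofReal_integral_le_lintegral_ofReal hint).trans (lintegral_mono hpt)
    _ = 8 * (ENNReal.ofReal (2 * s) * wolffEnergy s μ) := by
        rw [lintegral_const_mul' _ _ (by finiteness), ofReal_mul_wolffEnergy hs₀, tripleEnergy]
    _ ≤ 8 * (2 * wolffEnergy s μ) := by
        gcongr
        rw [← ENNReal.ofReal_ofNat]
        exact ENNReal.ofReal_le_ofReal (by linarith)
    _ = 16 * wolffEnergy s μ := by rw [← mul_assoc]; norm_num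

/-! ### Exhaustion, monotonicity and growth for the triple energy -/

lemma tripleEnergy_le_of_forall_restrict_ball {E : Type*} [NormedAddCommGroup E]
    [MeasurableSpace E] (s : ℝ) {μ : Measure E} [SFinite μ] {C : ℝ≥0∞}
    (h : ∀ R, tripleEnergy s (μ.restrict (Metric.ball 0 R)) ≤ C) : tripleEnergy s μ ≤ C := by
  set A : ℕ → Set (E × E × E) := fun n =>
    Metric.ball 0 (n : ℝ) ×ˢ Metric.ball 0 (n : ℝ) ×ˢ Metric.ball 0 (n : ℝ) with hA
  have hmono : Monotone A := fun m n hmn => by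
    have := Metric.ball_subset_ball (x := (0 : E)) (Nat.cast_le (α := ℝ).2 hmn)
    exact prod_mono this (prod_mono this this)
  have hUnion : ⋃ n, A n = univ := by
    refine eq_univ_of_forall fun p => mem_iUnion.2 ?_
    obtain ⟨n, hn⟩ := exists_nat_gt (max ‖p.1‖ (max ‖p.2.1‖ ‖p.2.2‖))
    simp only [max_lt_iff] at hn
    exact ⟨n, by simpa [hA] using hn⟩
  rw [tripleEnergy, ← setLIntegral_univ, ← hUnion,
    setLIntegral_iUnion_of_directed _ hmono.directed_le]
  refine iSup_le fun n => ?_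
  rw [hA, ← Measure.prod_restrict, ← Measure.prod_restrict]
  exact h n

lemma tripleEnergy_le_of_le_smul {E : Type*} [NormedAddCommGroup E] [MeasurableSpace E]
    [BorelSpace E] [SecondCountableTopology E] (s : ℝ) {μ ν : Measure E} [SFinite μ] [SFinite ν]
    {c : ℝ≥0∞}
    (hc : c ≠ ∞) (h : μ ≤ c • ν) : tripleEnergy s μ ≤ c ^ 3 * tripleEnergy s ν := by
  have hmono : ∀ f : E → ℝ≥0∞, ∫⁻ x, f x ∂μ ≤ c * ∫⁻ x, f x ∂ν := fun f =>
    (lintegral_mono' h le_rfl).trans_eq (lintegral_smul_measure _ _)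
  have hexp : ∀ (η : Measure E) [SFinite η], tripleEnergy s η =
      ∫⁻ x, ∫⁻ y, ∫⁻ z, tripleKernel s (x, y, z) ∂η ∂η ∂η := by
    intro η _
    rw [tripleEnergy, lintegral_prod _ (by fun_prop)]
    refine lintegral_congr fun x => ?_
    rw [lintegral_prod _ (by fun_prop)]
  rw [hexp μ, hexp ν]
  calc ∫⁻ x, ∫⁻ y, ∫⁻ z, tripleKernel s (x, y, z) ∂μ ∂μ ∂μ
      ≤ ∫⁻ x, ∫⁻ y, c * ∫⁻ z, tripleKernel s (x, y, z) ∂ν ∂μ ∂μ := by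
        gcongr with x y; exact hmono _
    _ ≤ ∫⁻ x, c * ∫⁻ y, c * ∫⁻ z, tripleKernel s (x, y, z) ∂ν ∂ν ∂μ := by
        gcongr with x; exact hmono _
    _ ≤ c * ∫⁻ x, c * ∫⁻ y, c * ∫⁻ z, tripleKernel s (x, y, z) ∂ν ∂ν ∂ν := hmono _
    _ = _ := by
        simp_rw [lintegral_const_mul' _ _ hc]
        ring

/-- Finite triple energy forces the growth of the measure to be `o(r^(2s/3))`. -/
lemma tendsto_measure_ball_pow_div {E : Type*} [NormedAddCommGroup E] [MeasurableSpace E]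
    [BorelSpace E] {s : ℝ} (hs₀ : 0 < s) (hs₁ : s < 1) (μ : Measure E)
    [SFinite μ] (hμ : tripleEnergy s μ < ∞) :
    Tendsto (fun r : ℝ => μ (Metric.ball 0 r) ^ 3 / ENNReal.ofReal (r ^ (2 * s))) atTop
      (nhds 0) := by
  set B : ℝ → Set (E × E × E) := fun r =>
    Metric.ball 0 r ×ˢ Metric.ball 0 r ×ˢ Metric.ball 0 r with hB
  have hBm : ∀ r, MeasurableSet (B r) := fun r =>
    measurableSet_ball.prod (measurableSet_ball.prod measurableSet_ball)
  have heq : (fun r : ℝ => μ (Metric.ball 0 r) ^ 3 / ENNReal.ofReal (r ^ (2 * s))) = fun r =>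
      ∫⁻ p, (B r).indicator (fun _ => (ENNReal.ofReal (r ^ (2 * s)))⁻¹) p
        ∂(μ.prod (μ.prod μ)) := by
    ext r
    rw [lintegral_indicator (hBm r), setLIntegral_const, Measure.prod_prod, Measure.prod_prod,
      ENNReal.div_eq_inv_mul]
    ring
  have hlim : Tendsto (fun r : ℝ => (ENNReal.ofReal (r ^ (2 * s)))⁻¹) atTop (nhds 0) := by
    rw [← ENNReal.inv_top]
    exact (continuous_inv.tendsto _).comp
      (ENNReal.tendsto_ofReal_atTop.comp (tendsto_rpow_atTop (by linarith)))
  rw [heq, ← lintegral_zero (μ := μ.prod (μ.prod μ))]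
  -- Three points of `B(0, r)` have mutual distances at most `2r`, so `r ^ (-2s)` is dominated there
  -- by four times the triple kernel.
  refine tendsto_lintegral_filter_of_dominated_convergence (fun p => 4 * tripleKernel s p)
    (Eventually.of_forall fun r => by fun_prop (disch := exact hBm r)) ?_ ?_ ?_
  · filter_upwards [eventually_gt_atTop 0] with r hr
    refine Eventually.of_forall fun p => ?_
    by_cases hp : p ∈ B r
    swap
    · rw [indicator_of_notMem hp]; exact zero_le
    rw [indicator_of_mem hp]
    simp only [hB, mem_prod, mem_ball_zero_iff] at hp
    have hM : max ‖p.2.1 - p.1‖ ‖p.2.2 - p.1‖ ≤ 2 * r := by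
      refine max_le ((norm_sub_le _ _).trans ?_) ((norm_sub_le _ _).trans ?_) <;> linarith
    calc (ENNReal.ofReal (r ^ (2 * s)))⁻¹ = ENNReal.ofReal (r ^ (-(2 * s))) := by
          rw [Real.rpow_neg hr.le, ENNReal.ofReal_inv_of_pos (by positivity)]
      _ ≤ ENNReal.ofReal (4 * (2 * r) ^ (-(2 * s))) := by
          refine ENNReal.ofReal_le_ofReal ?_
          rw [Real.mul_rpow (by norm_num) hr.le, ← mul_assoc]
          refine le_mul_of_one_le_left (by positivity) ?_
          calc (1 : ℝ) = 4 * 2 ^ (-2 : ℝ) := by norm_num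
            _ ≤ 4 * 2 ^ (-(2 * s)) := by
              gcongr
              · norm_num
              · linarith
      _ = 4 * ENNReal.ofReal (2 * r) ^ (-(2 * s)) := by
          rw [ENNReal.ofReal_mul (by norm_num), ENNReal.ofReal_ofNat,
            ENNReal.ofReal_rpow_of_pos (by positivity)]
      _ ≤ 4 * tripleKernel s p := by
          gcongr
          exact ENNReal.rpow_neg_le_rpow_neg (by linarith) (ENNReal.ofReal_le_ofReal hM)
  · rw [lintegral_const_mul' _ _ (by finiteness)]
    exact (ENNReal.mul_lt_top (by finiteness) hμ).ne
  · refine Eventually.of_forall fun p => ?_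
    refine tendsto_of_tendsto_of_tendsto_of_le_of_le tendsto_const_nhds hlim
      (fun _ => zero_le) fun r => ?_
    exact indicator_le_self _ _ p

/-! ### The lower bound for boundedly supported measures -/

/-- The constant in the lower bound for the symmetrized Riesz kernel. -/
noncomputable def lowerConst (s : ℝ) : ℝ := (1 - (1 / 2) ^ ((1 - s) / 2)) / 8

lemma lowerConst_pos {s : ℝ} (hs₁ : s < 1) : 0 < lowerConst s := by
  have : ((1 : ℝ) / 2) ^ ((1 - s) / 2) < 1 :=
    Real.rpow_lt_one (by norm_num) (by norm_num) (by linarith)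
  unfold lowerConst
  linarith

/-- The support has diameter at most `2ρ`, so the outer truncation removes nothing and the
symmetrized integrand is nonnegative almost everywhere. Triples with a side at most `ε` can
therefore be discarded; as `ε` decreases to `0` the remaining ones exhaust everything off the
diagonals, which are null as there are no atoms. -/
lemma lowerConst_mul_tripleEnergy_le {d : ℕ} {s ρ : ℝ} (hs₀ : 0 < s) (hs₁ : s < 1) (hρ : 0 < ρ)
    (ν : Measure (EuclideanSpace ℝ (Fin d))) [IsFiniteMeasure ν] [NullSingletonClass ν]
    (hν : ∀ᵐ x ∂ν, ‖x‖ < ρ) {B : ℝ≥0∞}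
    (hB : ∀ ε, 0 < ε → ε < 2 * ρ → truncRieszEnergy s ε (2 * ρ) ν ≤ B) :
    ENNReal.ofReal (lowerConst s) * tripleEnergy s ν ≤ 3 * B := by
  set X := EuclideanSpace ℝ (Fin d)
  have hfin : ∫⁻ x, ν (Metric.closedBall x (2 * ρ)) ^ 2 ∂ν < ∞ := by
    calc _ ≤ ∫⁻ _, ν univ ^ 2 ∂ν := by gcongr; exact subset_univ _
      _ < ∞ := by rw [lintegral_const]; finiteness
  have hsupp : ∀ᵐ p ∂(ν.prod (ν.prod ν)), ‖p.1‖ < ρ ∧ ‖p.2.1‖ < ρ ∧ ‖p.2.2‖ < ρ := by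
    have h₂ : ∀ᵐ q ∂(ν.prod ν), ‖q.1‖ < ρ ∧ ‖q.2‖ < ρ :=
      (Measure.quasiMeasurePreserving_fst.ae hν).and (Measure.quasiMeasurePreserving_snd.ae hν)
    exact (Measure.quasiMeasurePreserving_fst.ae hν).and
      (Measure.quasiMeasurePreserving_snd.ae h₂)
  set A : ℝ → Set (X × X × X) := fun ε =>
    {p | ε < ‖p.2.1 - p.2.2‖ ∧ ε < ‖p.2.2 - p.1‖ ∧ ε < ‖p.2.1 - p.1‖} with hA
  have hAm : ∀ ε, MeasurableSet (A ε) := fun ε =>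
    (measurableSet_lt (g := fun p : X × X × X => ‖p.2.1 - p.2.2‖) (by fun_prop) (by fun_prop)).inter
      ((measurableSet_lt (g := fun p : X × X × X => ‖p.2.2 - p.1‖) (by fun_prop)
        (by fun_prop)).inter
      (measurableSet_lt (g := fun p : X × X × X => ‖p.2.1 - p.1‖) (by fun_prop) (by fun_prop)))
  have hstep : ∀ ε, 0 < ε → ε < 2 * ρ →
      ∫⁻ p in A ε, ENNReal.ofReal (lowerConst s) * tripleKernel s p ∂(ν.prod (ν.prod ν)) ≤
        3 * B := by
    intro ε hε hερ
    obtain ⟨hint, hE⟩ := integrable_kernelSum_and_three_mul_energy (ε₂ := 2 * ρ) hs₀ hε ν hfin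
    have hdist : ∀ u v : X, ‖u‖ < ρ → ‖v‖ < ρ → ‖u - v‖ ≤ 2 * ρ := fun u v hu hv =>
      (norm_sub_le u v).trans (by linarith)
    have hnn : 0 ≤ᵐ[ν.prod (ν.prod ν)] kernelSum (truncKernel s ε (2 * ρ)) := by
      filter_upwards [hsupp] with p ⟨h₁, h₂, h₃⟩
      exact kernelSum_nonneg hs₀ hs₁ hε p.1 p.2.1 p.2.2 (hdist _ _ h₂ h₃) (hdist _ _ h₃ h₁)
        (hdist _ _ h₂ h₁)
    refine le_trans ?_ (mul_le_mul_right (hB ε hε hερ) 3)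
    rw [hE, ofReal_integral_eq_lintegral_ofReal hint hnn, ← lintegral_indicator (hAm ε)]
    refine lintegral_mono_ae ?_
    filter_upwards [hsupp] with p ⟨h₁, h₂, h₃⟩
    by_cases hp : p ∈ A ε
    · rw [indicator_of_mem hp, tripleKernel,
        ENNReal.ofReal_rpow_of_pos (lt_max_of_lt_left (hε.trans hp.2.2)),
        ← ENNReal.ofReal_mul (lowerConst_pos hs₁).le]
      exact ENNReal.ofReal_le_ofReal (le_kernelSum hs₀ hs₁ hε p.1 p.2.1 p.2.2 (hdist _ _ h₂ h₃)
        (hdist _ _ h₃ h₁) (hdist _ _ h₂ h₁) hp.1 hp.2.1 hp.2.2)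
    · rw [indicator_of_notMem hp]; exact zero_le
  -- The shift by `2` keeps `e 0` strictly below `2ρ`.
  set e : ℕ → ℝ := fun n => 2 * ρ / (n + 2) with he
  have he0 : ∀ n, 0 < e n := fun n => by positivity
  have he1 : ∀ n, e n < 2 * ρ := fun n => by
    rw [he, div_lt_iff₀ (by positivity)]
    have : (0 : ℝ) ≤ n := by positivity
    nlinarith
  have hanti : Antitone e := fun m n hmn => by
    have : (m : ℝ) ≤ n := by exact_mod_cast hmn
    simp only [he]; gcongr
  have hmono : Monotone fun n => A (e n) := fun m n hmn p hp =>
    ⟨(hanti hmn).trans_lt hp.1, (hanti hmn).trans_lt hp.2.1, (hanti hmn).trans_lt hp.2.2⟩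
  have htend : Tendsto e atTop (nhds 0) := by
    have h := (tendsto_const_div_atTop_nhds_zero_nat (2 * ρ)).comp (tendsto_add_atTop_nat 2)
    refine h.congr fun n => ?_
    simp [he]
  have hdiag : ∀ᵐ p ∂(ν.prod (ν.prod ν)), p.2.1 ≠ p.2.2 ∧ p.2.2 ≠ p.1 ∧ p.2.1 ≠ p.1 := by
    have h₂ : ∀ᵐ q ∂(ν.prod ν), q.1 ≠ q.2 := by
      refine (Measure.ae_prod_iff_ae_ae ?_).2 (Eventually.of_forall fun x => ?_)
      · exact (measurableSet_eq_fun measurable_fst measurable_snd).compl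
      · filter_upwards [ν.ae_ne x] with y hy using hy.symm
    have h₃ : ∀ᵐ p ∂(ν.prod (ν.prod ν)), p.2.1 ≠ p.1 ∧ p.2.2 ≠ p.1 := by
      refine (Measure.ae_prod_iff_ae_ae ?_).2 (Eventually.of_forall fun x => ?_)
      · exact ((measurableSet_eq_fun (by fun_prop) (by fun_prop)).compl).inter
          ((measurableSet_eq_fun (by fun_prop) (by fun_prop)).compl)
      · exact (Measure.quasiMeasurePreserving_fst.ae (ν.ae_ne x)).and
          (Measure.quasiMeasurePreserving_snd.ae (ν.ae_ne x))
    filter_upwards [Measure.quasiMeasurePreserving_snd.ae h₂, h₃] with p hp hq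
    exact ⟨hp, hq.2, hq.1⟩
  have hUnion : (⋃ n, A (e n) : Set (X × X × X)) =ᵐ[ν.prod (ν.prod ν)] univ := by
    rw [eventuallyEq_univ]
    filter_upwards [hdiag] with p ⟨h₁, h₂, h₃⟩
    have hpos : 0 < min ‖p.2.1 - p.2.2‖ (min ‖p.2.2 - p.1‖ ‖p.2.1 - p.1‖) :=
      lt_min (norm_pos_iff.2 (sub_ne_zero.2 h₁)) (lt_min (norm_pos_iff.2 (sub_ne_zero.2 h₂))
        (norm_pos_iff.2 (sub_ne_zero.2 h₃)))
    obtain ⟨n, hn⟩ := (htend.eventually_lt_const hpos).exists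
    simp only [lt_min_iff] at hn
    exact mem_iUnion.2 ⟨n, hn⟩
  rw [tripleEnergy, ← lintegral_const_mul' _ _ (by finiteness), ← setLIntegral_univ,
    ← setLIntegral_congr hUnion, setLIntegral_iUnion_of_directed _ hmono.directed_le]
  exact iSup_le fun n => hstep _ (he0 n) (he1 n)

/-! ### Localization by a Lipschitz cutoff -/

/-- The cone-shaped cutoff `max(0, 1 - |x| / ρ)`. -/
noncomputable def coneCutoff {E : Type*} [NormedAddCommGroup E] (ρ : ℝ) (x : E) : ℝ≥0 :=
  Real.toNNReal (1 - ‖x‖ / ρ)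

lemma abs_coneCutoff_sub_le {E : Type*} [NormedAddCommGroup E] {ρ : ℝ} (hρ : 0 < ρ) (x y : E) :
    |(coneCutoff ρ y : ℝ) - coneCutoff ρ x| ≤ ‖y - x‖ / ρ := by
  simp only [coneCutoff, Real.coe_toNNReal']
  refine (abs_max_sub_max_le_abs _ _ _).trans ?_
  rw [show 1 - ‖y‖ / ρ - (1 - ‖x‖ / ρ) = (‖x‖ - ‖y‖) / ρ by ring, abs_div, abs_of_pos hρ]
  gcongr
  rw [norm_sub_rev]
  exact abs_norm_sub_norm_le _ _

lemma coneCutoff_le_one {E : Type*} [NormedAddCommGroup E] {ρ : ℝ} (hρ : 0 < ρ) (x : E) :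
    coneCutoff ρ x ≤ 1 := by
  rw [coneCutoff, Real.toNNReal_le_one]
  have : 0 ≤ ‖x‖ / ρ := by positivity
  linarith

@[fun_prop]
lemma measurable_coneCutoff {E : Type*} [NormedAddCommGroup E] [MeasurableSpace E] [BorelSpace E]
    (ρ : ℝ) : Measurable (coneCutoff ρ : E → ℝ≥0) := by
  unfold coneCutoff
  fun_prop

section Localization

variable {d : ℕ} (μ : Measure (EuclideanSpace ℝ (Fin d))) {ρ : ℝ}

/-- The measure `μ` cut off by the cone of radius `ρ`. -/
noncomputable def coneMeasure (ρ : ℝ) : Measure (EuclideanSpace ℝ (Fin d)) :=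
  μ.withDensity fun x => (coneCutoff ρ x : ℝ≥0∞)

lemma coneMeasure_le (hρ : 0 < ρ) : coneMeasure μ ρ ≤ μ := by
  calc coneMeasure μ ρ ≤ μ.withDensity 1 := by
        refine withDensity_mono (Eventually.of_forall fun x => ?_)
        exact ENNReal.coe_le_one_iff.2 (coneCutoff_le_one hρ x)
    _ = μ := withDensity_one

lemma ae_coneMeasure_norm_lt (hρ : 0 < ρ) : ∀ᵐ x ∂(coneMeasure μ ρ), ‖x‖ < ρ := by
  rw [coneMeasure, ae_withDensity_iff (by fun_prop)]
  refine Eventually.of_forall fun x hx => ?_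
  by_contra h
  refine hx ?_
  rw [ENNReal.coe_eq_zero, coneCutoff, Real.toNNReal_eq_zero, sub_nonpos, one_le_div hρ]
  exact not_lt.1 h

lemma coneMeasure_univ_le (hρ : 0 < ρ) {r : ℝ} (hr : ρ ≤ r) :
    coneMeasure μ ρ univ ≤ μ (Metric.ball 0 r) := by
  calc coneMeasure μ ρ univ ≤ coneMeasure μ ρ (Metric.ball 0 ρ) := by
        refine measure_mono_ae ?_
        filter_upwards [ae_coneMeasure_norm_lt μ hρ] with x hx _
        exact mem_ball_zero_iff.2 hx
    _ ≤ μ (Metric.ball 0 ρ) := coneMeasure_le μ hρ _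
    _ ≤ _ := measure_mono (Metric.ball_subset_ball hr)

lemma restrict_ball_le_coneMeasure (hρ : 0 < ρ) {R : ℝ} (hR : 2 * R ≤ ρ) :
    μ.restrict (Metric.ball 0 R) ≤ (2 : ℝ≥0∞) • coneMeasure μ ρ := by
  rw [coneMeasure, ← withDensity_smul _ (by fun_prop),
    ← withDensity_indicator_one Metric.isOpen_ball.measurableSet]
  refine withDensity_mono (Eventually.of_forall fun x => ?_)
  refine indicator_le (fun x hx => ?_) x
  have h : (1 : ℝ≥0) ≤ 2 * coneCutoff ρ x := by
    rw [← NNReal.coe_le_coe, NNReal.coe_mul, coneCutoff, Real.coe_toNNReal']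
    have : ‖x‖ / ρ ≤ 1 / 2 := by
      rw [div_le_iff₀ hρ]
      have := mem_ball_zero_iff.1 hx
      linarith
    have h' := le_max_left (1 - ‖x‖ / ρ) 0
    push_cast
    linarith
  simp only [Pi.one_apply, Pi.smul_apply, smul_eq_mul]
  exact_mod_cast h

/-- Commutator estimate: it is here that `s < 1` enters for the localization. -/
lemma norm_coneCutoff_sub_smul_truncKernel_le {E : Type*} [NormedAddCommGroup E]
    [NormedSpace ℝ E] {s ε ρ : ℝ} (hs₀ : 0 < s) (hs₁ : s < 1) (hε : 0 < ε) (hρ : 0 < ρ) (x y : E) :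
    ‖((coneCutoff ρ y : ℝ) - coneCutoff ρ x) • truncKernel s ε (2 * ρ) (y - x)‖ ≤
      2 * ρ ^ (-s) := by
  by_cases h : ε < ‖y - x‖ ∧ ‖y - x‖ ≤ 2 * ρ
  · have h0 := hε.trans h.1
    rw [norm_smul, truncKernel, norm_smul, Real.norm_of_nonneg (truncProfile_nonneg hε),
      Real.norm_eq_abs]
    -- The Lipschitz bound gains one power of `|y - x|`, leaving the positive exponent `1 - s`;
    -- hence the estimate is uniform in `ε`.
    calc _ ≤ ‖y - x‖ / ρ * ‖y - x‖ ^ (-s) := by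
          gcongr
          · exact mul_nonneg (truncProfile_nonneg hε) h0.le
          · exact abs_coneCutoff_sub_le hρ x y
          · exact truncProfile_mul_le h0
      _ = ‖y - x‖ ^ (1 - s) / ρ := by
          rw [sub_eq_add_neg 1 s, Real.rpow_add h0, Real.rpow_one]; ring
      _ ≤ (2 * ρ) ^ (1 - s) / ρ := by gcongr; exact h.2
      _ = 2 ^ (1 - s) * ρ ^ (-s) := by
          rw [Real.mul_rpow (by norm_num) hρ.le, sub_eq_add_neg, Real.rpow_add hρ, Real.rpow_one]
          field_simp
      _ ≤ 2 ^ (1 : ℝ) * ρ ^ (-s) := by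
          gcongr
          · norm_num
          · linarith
      _ = 2 * ρ ^ (-s) := by rw [Real.rpow_one]
  · have : truncProfile s ε (2 * ρ) ‖y - x‖ = 0 := if_neg h
    rw [truncKernel, this]
    simp only [zero_smul, smul_zero, norm_zero]
    positivity

/-- Replacing the cutoff at `y` by its value at `x` gives at most the original transform; the
difference is the commutator. Its integrand vanishes unless `|y - x| ≤ 2ρ`, and then `|y| < 3ρ`, so
`B(0, 4ρ)` is large enough. -/
lemma enorm_truncRiesz_coneMeasure_le [IsLocallyFiniteMeasure μ] {s ε : ℝ} (hs₀ : 0 < s)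
    (hs₁ : s < 1) (hε : 0 < ε) (hρ : 0 < ρ) {x : EuclideanSpace ℝ (Fin d)} (hx : ‖x‖ < ρ) :
    ‖truncRiesz s ε (2 * ρ) (coneMeasure μ ρ) x‖ₑ ≤
      ‖truncRiesz s ε (2 * ρ) μ x‖ₑ +
        ENNReal.ofReal (2 * ρ ^ (-s)) * μ (Metric.ball 0 (4 * ρ)) := by
  set k : EuclideanSpace ℝ (Fin d) → EuclideanSpace ℝ (Fin d) := truncKernel s ε (2 * ρ) with hk
  have hkm : Measurable k := measurable_truncKernel _ _ _
  have hint : Integrable (fun y => k (y - x)) μ := by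
    refine ⟨(hkm.comp (measurable_sub_const x)).aestronglyMeasurable,
      (lintegral_mono (enorm_truncKernel_le hs₀ hε x)).trans_lt ?_⟩
    rw [lintegral_indicator Metric.isClosed_closedBall.measurableSet, setLIntegral_const]
    exact ENNReal.mul_lt_top ENNReal.ofReal_lt_top measure_closedBall_lt_top
  have hint₂ : Integrable (fun y => (coneCutoff ρ y : ℝ) • k (y - x)) μ := by
    refine hint.norm.mono' (by fun_prop) (Eventually.of_forall fun y => ?_)
    rw [norm_smul, Real.norm_of_nonneg (NNReal.coe_nonneg _)]
    exact mul_le_of_le_one_left (norm_nonneg _) (coneCutoff_le_one hρ y)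
  have hsplit : truncRiesz s ε (2 * ρ) (coneMeasure μ ρ) x =
      (coneCutoff ρ x : ℝ) • truncRiesz s ε (2 * ρ) μ x +
        ∫ y, ((coneCutoff ρ y : ℝ) - coneCutoff ρ x) • k (y - x) ∂μ := by
    rw [truncRiesz_eq, truncRiesz_eq, coneMeasure,
      integral_withDensity_eq_integral_smul (by fun_prop), ← integral_smul]
    simp_rw [sub_smul]
    have := integral_sub hint₂ (hint.smul (coneCutoff ρ x : ℝ))
    simp only [Pi.smul_apply] at this
    rw [this]
    simp [NNReal.smul_def, hk]
  rw [hsplit]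
  refine (enorm_add_le _ _).trans (add_le_add ?_ ?_)
  · rw [enorm_smul]
    refine mul_le_of_le_one_left' ?_
    rw [← ofReal_norm, Real.norm_of_nonneg (NNReal.coe_nonneg _)]
    exact ENNReal.ofReal_le_one.2 (coneCutoff_le_one hρ x)
  · calc _ ≤ ∫⁻ y, ‖((coneCutoff ρ y : ℝ) - coneCutoff ρ x) • k (y - x)‖ₑ ∂μ :=
          enorm_integral_le_lintegral_enorm _
      _ ≤ ∫⁻ y, (Metric.ball 0 (4 * ρ)).indicator
            (fun _ => ENNReal.ofReal (2 * ρ ^ (-s))) y ∂μ := by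
          refine lintegral_mono fun y => ?_
          by_cases hy : y ∈ Metric.ball 0 (4 * ρ)
          · rw [indicator_of_mem hy, ← ofReal_norm]
            exact ENNReal.ofReal_le_ofReal
              (norm_coneCutoff_sub_smul_truncKernel_le hs₀ hs₁ hε hρ x y)
          · have hyx : ¬ ‖y - x‖ ≤ 2 * ρ := by
              rw [mem_ball_zero_iff] at hy
              have := norm_sub_norm_le y x
              intro h
              linarith
            simp [hk, truncKernel, truncProfile, hyx]
      _ = _ := by
          rw [lintegral_indicator Metric.isOpen_ball.measurableSet, setLIntegral_const]

lemma ENNReal.add_sq_le (a b : ℝ≥0∞) : (a + b) ^ 2 ≤ 4 * a ^ 2 + 4 * b ^ 2 := by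
  rcases le_total a b with h | h
  · calc (a + b) ^ 2 ≤ (b + b) ^ 2 := by gcongr
      _ = 4 * b ^ 2 := by ring
      _ ≤ _ := le_add_self
  · calc (a + b) ^ 2 ≤ (a + a) ^ 2 := by gcongr
      _ = 4 * a ^ 2 := by ring
      _ ≤ _ := le_self_add

/-- The squared commutator error, integrated over a mass at most `m`, is of order `m³ ρ ^ (-2s)`,
which is the ratio in the growth hypothesis. The constant is `256 = 4 · 2² · 16`, with `16` from `4
^ (2s) ≤ 16`. -/
lemma truncRieszEnergy_coneMeasure_le [IsLocallyFiniteMeasure μ] {s ε : ℝ} (hs₀ : 0 < s)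
    (hs₁ : s < 1) (hε : 0 < ε) (hρ : 0 < ρ) :
    truncRieszEnergy s ε (2 * ρ) (coneMeasure μ ρ) ≤
      256 * (truncRieszEnergy s ε (2 * ρ) μ +
        μ (Metric.ball 0 (4 * ρ)) ^ 3 / ENNReal.ofReal ((4 * ρ) ^ (2 * s))) := by
  set m := μ (Metric.ball 0 (4 * ρ)) with hm
  set c := ENNReal.ofReal (2 * ρ ^ (-s)) with hc
  have hconst : 4 * c ^ 2 ≤ 256 * (ENNReal.ofReal ((4 * ρ) ^ (2 * s)))⁻¹ := by
    rw [hc, ← ENNReal.ofReal_pow (by positivity), ← ENNReal.ofReal_inv_of_pos (by positivity),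
      ← ENNReal.ofReal_ofNat 4, ← ENNReal.ofReal_ofNat 256, ← ENNReal.ofReal_mul (by norm_num),
      ← ENNReal.ofReal_mul (by norm_num)]
    refine ENNReal.ofReal_le_ofReal ?_
    have h4 : (4 : ℝ) ^ (2 * s) ≤ 16 := by
      calc (4 : ℝ) ^ (2 * s) ≤ 4 ^ (2 : ℝ) := by
            gcongr
            · norm_num
            · linarith
        _ = 16 := by norm_num
    have hsq : (ρ ^ (-s)) ^ 2 = (ρ ^ (2 * s))⁻¹ := by
      rw [← Real.rpow_natCast, ← Real.rpow_mul hρ.le, ← Real.rpow_neg hρ.le]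
      congr 1; push_cast; ring
    rw [Real.mul_rpow (by norm_num) hρ.le, mul_pow, hsq, mul_inv]
    have hp : 0 < ρ ^ (2 * s) := by positivity
    have h16 : (1 / 16 : ℝ) ≤ (4 ^ (2 * s))⁻¹ := by
      rw [one_div]; gcongr
    have := mul_le_mul_of_nonneg_right h16 (inv_nonneg.2 hp.le)
    linarith
  calc truncRieszEnergy s ε (2 * ρ) (coneMeasure μ ρ)
      ≤ ∫⁻ x, 4 * ‖truncRiesz s ε (2 * ρ) μ x‖ₑ ^ 2 + 4 * (c * m) ^ 2 ∂(coneMeasure μ ρ) := by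
        refine lintegral_mono_ae ?_
        filter_upwards [ae_coneMeasure_norm_lt μ hρ] with x hx
        refine le_trans ?_ (ENNReal.add_sq_le _ _)
        gcongr
        exact enorm_truncRiesz_coneMeasure_le μ hs₀ hs₁ hε hρ hx
    _ = 4 * (∫⁻ x, ‖truncRiesz s ε (2 * ρ) μ x‖ₑ ^ 2 ∂(coneMeasure μ ρ))
          + 4 * (c * m) ^ 2 * coneMeasure μ ρ univ := by
        rw [lintegral_add_right _ measurable_const, lintegral_const_mul' _ _ (by finiteness),
          lintegral_const]
    _ ≤ 4 * truncRieszEnergy s ε (2 * ρ) μ + 4 * (c * m) ^ 2 * m := by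
        gcongr
        · exact lintegral_mono' (coneMeasure_le μ hρ) le_rfl
        · exact coneMeasure_univ_le μ hρ (by linarith)
    _ = 4 * truncRieszEnergy s ε (2 * ρ) μ + 4 * c ^ 2 * m ^ 3 := by ring
    _ ≤ 256 * truncRieszEnergy s ε (2 * ρ) μ +
          256 * (ENNReal.ofReal ((4 * ρ) ^ (2 * s)))⁻¹ * m ^ 3 := by
        gcongr
        norm_num
    _ = _ := by rw [ENNReal.div_eq_inv_mul]; ring

/-! ### Conclusion of the lower bound (b) -/

/-- The constant in the localized lower bound. -/
noncomputable def localConst (s : ℝ) : ℝ≥0∞ := 6144 / ENNReal.ofReal (lowerConst s)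

lemma localConst_ne_top {s : ℝ} (hs₁ : s < 1) : localConst s ≠ ∞ :=
  ENNReal.div_ne_top (by finiteness) (ENNReal.ofReal_pos.2 (lowerConst_pos hs₁)).ne'

lemma localConst_ne_zero (s : ℝ) : localConst s ≠ 0 :=
  (ENNReal.div_pos (by norm_num) ENNReal.ofReal_ne_top).ne'

/-- The cutoff is at least `1/2` on `B(0, R)`, and the triple energy is cubic in the measure. Thus
`6144 = 2³ · 3 · 256`. -/
lemma tripleEnergy_restrict_ball_le [IsLocallyFiniteMeasure μ] (hμ : ∀ x, μ {x} = 0) {s R : ℝ}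
    (hs₀ : 0 < s) (hs₁ : s < 1) (hρ : 0 < ρ) (hR : 2 * R ≤ ρ) :
    tripleEnergy s (μ.restrict (Metric.ball 0 R)) ≤
      localConst s * ((⨆ (ε₁ : ℝ) (ε₂ : ℝ) (_ : 0 < ε₁) (_ : ε₁ < ε₂),
        truncRieszEnergy s ε₁ ε₂ μ) +
          μ (Metric.ball 0 (4 * ρ)) ^ 3 / ENNReal.ofReal ((4 * ρ) ^ (2 * s))) := by
  set S := ⨆ (ε₁ : ℝ) (ε₂ : ℝ) (_ : 0 < ε₁) (_ : ε₁ < ε₂), truncRieszEnergy s ε₁ ε₂ μ with hS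
  set A := μ (Metric.ball 0 (4 * ρ)) ^ 3 / ENNReal.ofReal ((4 * ρ) ^ (2 * s)) with hA
  have hfin : IsFiniteMeasure (coneMeasure μ ρ) :=
    ⟨(coneMeasure_univ_le μ hρ le_rfl).trans_lt measure_ball_lt_top⟩
  have hatom : NullSingletonClass (coneMeasure μ ρ) :=
    ⟨fun x => le_antisymm ((coneMeasure_le μ hρ _).trans (hμ x).le) zero_le⟩
  have key := lowerConst_mul_tripleEnergy_le hs₀ hs₁ hρ (coneMeasure μ ρ)
    (ae_coneMeasure_norm_lt μ hρ) (B := 256 * (S + A)) fun ε hε hερ => by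
      refine (truncRieszEnergy_coneMeasure_le μ hs₀ hs₁ hε hρ).trans ?_
      gcongr
      exact le_iSup₂_of_le ε (2 * ρ) (le_iSup₂_of_le hε hερ le_rfl)
  have hc0 : ENNReal.ofReal (lowerConst s) ≠ 0 := (ENNReal.ofReal_pos.2 (lowerConst_pos hs₁)).ne'
  calc tripleEnergy s (μ.restrict (Metric.ball 0 R))
      ≤ 2 ^ 3 * tripleEnergy s (coneMeasure μ ρ) :=
        tripleEnergy_le_of_le_smul s (by finiteness) (restrict_ball_le_coneMeasure μ hρ hR)
    _ ≤ 2 ^ 3 * (3 * (256 * (S + A)) / ENNReal.ofReal (lowerConst s)) := by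
        gcongr
        rw [ENNReal.le_div_iff_mul_le (.inl hc0) (.inl ENNReal.ofReal_ne_top), mul_comm]
        exact key
    _ = localConst s * (S + A) := by
        rw [localConst, ENNReal.div_eq_inv_mul, ENNReal.div_eq_inv_mul]
        ring

lemma tripleEnergy_le_of_frequently [IsLocallyFiniteMeasure μ] (hμ : ∀ x, μ {x} = 0) {s : ℝ}
    (hs₀ : 0 < s) (hs₁ : s < 1) {a : ℝ≥0∞}
    (ha : ∃ᶠ r : ℝ in atTop, μ (Metric.ball 0 r) ^ 3 / ENNReal.ofReal (r ^ (2 * s)) < a) :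
    tripleEnergy s μ ≤ localConst s * ((⨆ (ε₁ : ℝ) (ε₂ : ℝ) (_ : 0 < ε₁) (_ : ε₁ < ε₂),
        truncRieszEnergy s ε₁ ε₂ μ) + a) := by
  refine tripleEnergy_le_of_forall_restrict_ball s fun R => ?_
  obtain ⟨r, hr, hr₁, hr₂⟩ := (ha.and_eventually
    ((eventually_gt_atTop 0).and (eventually_ge_atTop (8 * R)))).exists
  refine (tripleEnergy_restrict_ball_le μ hμ (ρ := r / 4) hs₀ hs₁ (by linarith)
    (by linarith)).trans ?_
  -- With `ρ = r / 4` the error ratio is evaluated exactly at the good radius `r`.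
  rw [mul_div_cancel₀ r (by norm_num : (4 : ℝ) ≠ 0)]
  gcongr

/-- A bootstrap: the estimate with a finite error `b` only shows that the triple energy is finite.
Finiteness forces the growth ratio to `0`, so the same estimate then holds with every error `a > 0`.
-/
lemma tripleEnergy_le_iSup [IsLocallyFiniteMeasure μ] (hμ : ∀ x, μ {x} = 0) {s : ℝ}
    (hs₀ : 0 < s) (hs₁ : s < 1)
    (hlim : liminf (fun r : ℝ => μ (Metric.ball 0 r) ^ 3 / ENNReal.ofReal (r ^ (2 * s))) atTop
      < ∞) :
    tripleEnergy s μ ≤ localConst s * ⨆ (ε₁ : ℝ) (ε₂ : ℝ) (_ : 0 < ε₁) (_ : ε₁ < ε₂),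
        truncRieszEnergy s ε₁ ε₂ μ := by
  have hfreq := fun a => tripleEnergy_le_of_frequently μ hμ hs₀ hs₁ (a := a)
  set S := ⨆ (ε₁ : ℝ) (ε₂ : ℝ) (_ : 0 < ε₁) (_ : ε₁ < ε₂), truncRieszEnergy s ε₁ ε₂ μ with hS
  rcases eq_or_ne S ∞ with hS' | hS'
  · rw [hS', ENNReal.mul_top (localConst_ne_zero s)]; exact le_top
  obtain ⟨b, hb, hb'⟩ := exists_between hlim
  have hfin : tripleEnergy s μ < ∞ :=
    (hfreq b (frequently_lt_of_liminf_lt (by isBoundedDefault) hb)).trans_lt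
      (ENNReal.mul_lt_top (localConst_ne_top hs₁).lt_top (ENNReal.add_lt_top.2 ⟨hS'.lt_top, hb'⟩))
  have hzero := tendsto_measure_ball_pow_div hs₀ hs₁ μ hfin
  have hle : ∀ a : ℝ≥0∞, 0 < a → tripleEnergy s μ ≤ localConst s * (S + a) := fun a ha =>
    hfreq a (hzero.eventually_lt_const ha).frequently
  have htend : Tendsto (fun n : ℕ => localConst s * (S + ((n : ℝ≥0∞))⁻¹)) atTop
      (nhds (localConst s * (S + 0))) :=
    ENNReal.Tendsto.const_mul (tendsto_const_nhds.add ENNReal.tendsto_inv_nat_nhds_zero)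
      (.inr (localConst_ne_top hs₁))
  rw [add_zero] at htend
  exact ge_of_tendsto' htend fun n => hle _ (ENNReal.inv_pos.2 (ENNReal.natCast_ne_top n))

end Localization

theorem proposition3p1 (d : ℕ) (s : ℝ) (hs₀ : 0 < s) (hs₁ : s < 1) :
    ∃ C : ℝ≥0, ∀ (μ : Measure (EuclideanSpace ℝ (Fin d))) [IsLocallyFiniteMeasure μ],
      (∀ ε₁ ε₂ : ℝ, 0 < ε₁ → 0 < ε₂ →
        truncRieszEnergy s ε₁ ε₂ μ ≤ C * wolffEnergy s μ) ∧
      ((∀ x, μ {x} = 0) →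
        liminf (fun r : ℝ => μ (Metric.ball 0 r) ^ 3 / ENNReal.ofReal (r ^ (2 * s))) atTop < ∞ →
        wolffEnergy s μ ≤
          C * ⨆ (ε₁ : ℝ) (ε₂ : ℝ) (_ : 0 < ε₁) (_ : ε₁ < ε₂), truncRieszEnergy s ε₁ ε₂ μ) := by
  have h2s : ENNReal.ofReal (2 * s) ≠ 0 := (ENNReal.ofReal_pos.2 (by linarith)).ne'
  have hK : localConst s / ENNReal.ofReal (2 * s) ≠ ∞ :=
    ENNReal.div_ne_top (localConst_ne_top hs₁) h2s
  refine ⟨max 16 (localConst s / ENNReal.ofReal (2 * s)).toNNReal, fun μ _ =>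
    ⟨fun ε₁ ε₂ hε₁ hε₂ => ?_, fun hμ hlim => ?_⟩⟩
  · refine (truncRieszEnergy_le hs₀ hs₁ hε₁ hε₂ μ).trans ?_
    gcongr
    exact_mod_cast le_max_left _ _
  · calc wolffEnergy s μ = (ENNReal.ofReal (2 * s))⁻¹ * tripleEnergy s μ := by
          rw [← ofReal_mul_wolffEnergy hs₀, ← mul_assoc,
            ENNReal.inv_mul_cancel h2s ENNReal.ofReal_ne_top, one_mul]
      _ ≤ (ENNReal.ofReal (2 * s))⁻¹ * (localConst s * _) := by
          gcongr
          exact tripleEnergy_le_iSup μ hμ hs₀ hs₁ hlim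
      _ = (localConst s / ENNReal.ofReal (2 * s)) * _ := by
          rw [ENNReal.div_eq_inv_mul, mul_assoc]
      _ ≤ _ := by
          gcongr
          rw [ENNReal.coe_max, ENNReal.coe_toNNReal hK]
          exact le_max_right _ _
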